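/- Consider the $(1:b)$ half-random Maker–Breaker game on the edge set of $K_n$: Maker goes first and occupies one free edge per turn according to a strategy; RandomBreaker then occupies $b$ edges per turn, one after the other, each uniformly at random among the currently free edges; the game lasts until no edge is free. In the perfect matching game ($n$ even) Maker wins if his graph has a perfect matching; in the minimum-degree-1 game Maker wins if every vertex has degree at least $1$ in his graph. In either game RandomBreaker wins if Maker does not. A function $k:\mathbb N_0\to\mathbb N_0$ is a \emph{sharp threshold bias} of a sequence of such games if for every $\varepsilon>0$: (a) for every sequence of strategies of Maker, RandomBreaker wins with bias $\lfloor(1+\varepsilon)k(n)\rfloor$ with probability tending to $1$; and (b) Maker has a sequence of strategies with which he wins against bias $\max(0,\lfloor(1-\varepsilon)k(n)\rfloor)$ with probability tending to $1$. Theorem. (i) For every $\varepsilon>0$ there are a constant $C=C(\varepsilon)$ and, for every $n$, a strategy of Maker in the game with bias $\max(0,\lfloor(1-\varepsilon)n\rfloor)$ such that, as $n\to\infty$ through the even integers, the probability that Maker's first $\lfloor \frac n2+C\log n\rfloor$ edges contain a perfect matching tends to $1$. (ii) $k(n)=n$ is a sharp threshold bias of the half-random perfect matching game (as $n\to\infty$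 through the even integers) and of the half-random minimum-degree-1 game (as $n\to\infty$ through all integers). -/

import Mathlib

open Filter Topology
open scoped ENNReal

noncomputable section

namespace HalfRandom

/-! ### Biased half-random Maker-Breaker games on a finite board

Maker is the clever player with one move per turn, Breaker has `b` moves per turn and always takes
a uniformly random free element. Maker goes first. -/

/-- A (deterministic) strategy on the board `E`: in every scenario, given by the play-sequence `h`
so far, in which some element is still free, it names a free element to be occupied. -/
structure Strategy (E : Type) where
  move : (h : List E) → (∃ e, e ∉ h) → E
  move_free : ∀ h hf, move h hf ∉ h

section Board

variable {E : Type} [Fintype E]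

open Classical in
/-- The free elements of the board once the play-sequence is `h`. -/
def freeSet (h : List E) : Finset E := Finset.univ.filter (fun e => e ∉ h)

theorem freeSet_nonempty {h : List E} (hf : ∃ e, e ∉ h) : (freeSet h).Nonempty := by
  obtain ⟨e, he⟩ := hf
  exact ⟨e, by simp [freeSet, he]⟩

open Classical in
/-- One move of the `(1 : b)` half-random game. The play-sequence is split into rounds of `b + 1`
moves; the first move of a round is Maker's, who follows `S`, the other `b` moves are Breaker's, who
takes a uniformly random free element. When the board is full nothing happens. -/
def step (b : ℕ) (S : Strategy E) (h : List E) : PMF (List E) :=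
  if hf : ∃ e, e ∉ h then
    if h.length % (b + 1) = 0 then PMF.pure (h ++ [S.move h hf])
    else (PMF.uniformOfFinset (freeSet h) (freeSet_nonempty hf)).map (fun e => h ++ [e])
  else PMF.pure h

/-- The law of the play-sequence after `m` moves (of both players together). -/
def playAfter (b : ℕ) (S : Strategy E) : ℕ → PMF (List E)
  | 0 => PMF.pure []
  | m + 1 => (playAfter b S m).bind (step b S)

/-- The law of the play-sequence of the whole game, which lasts until the board is full. -/
def play (b : ℕ) (S : Strategy E) : PMF (List E) := playAfter b S (Fintype.card E)

/-- The elements that Maker occupies with his first `t` moves in the play-sequence `γ`. -/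
def makerAfter (b t : ℕ) (γ : List E) : Set E := {e | ∃ i < t, γ[i * (b + 1)]? = some e}

/-- All the elements that Maker occupies in the play-sequence `γ`. -/
def makerSet (b : ℕ) (γ : List E) : Set E := {e | ∃ i, γ[i * (b + 1)]? = some e}

/-- The probability that Maker, playing by `S` in the `(1 : b)` half-random game with winning sets
`F`, has fully occupied a winning set within his first `t` moves. -/
def probMakerWinsWithin (F : Set (Set E)) (b : ℕ) (S : Strategy E) (t : ℕ) : ℝ≥0∞ :=
  (play b S).toOuterMeasure {γ | ∃ A ∈ F, A ⊆ makerAfter b t γ}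

/-- The probability that Maker wins, i.e. fully occupies a winning set. -/
def probMakerWins (F : Set (Set E)) (b : ℕ) (S : Strategy E) : ℝ≥0∞ :=
  (play b S).toOuterMeasure {γ | ∃ A ∈ F, A ⊆ makerSet b γ}

/-- The probability that Breaker wins, i.e. that Maker does not fully occupy any winning set. -/
def probBreakerWins (F : Set (Set E)) (b : ℕ) (S : Strategy E) : ℝ≥0∞ :=
  (play b S).toOuterMeasure {γ | ¬ ∃ A ∈ F, A ⊆ makerSet b γ}

end Board

/-! ### Games on the edge set of the complete graph -/

/-- The edge set of the complete graph on `n` vertices. -/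
abbrev KEdge (n : ℕ) : Type := (⊤ : SimpleGraph (Fin n)).edgeSet

/-- The spanning graph on `n` vertices with a given set of edges. -/
def graphOf {n : ℕ} (A : Set (KEdge n)) : SimpleGraph (Fin n) :=
  SimpleGraph.fromEdgeSet (Subtype.val '' A)

/-- The perfect matching game: edge sets of graphs that have a perfect matching. -/
def perfectMatchingGame (n : ℕ) : Set (Set (KEdge n)) :=
  {A | ∃ M : (graphOf A).Subgraph, M.IsPerfectMatching}

open Classical in
/-- The minimum-degree-1 game: edge sets of graphs with all degrees at least one. -/
def minDegreeOneGame (n : ℕ) : Set (Set (KEdge n)) :=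
  {A | ∀ v, 1 ≤ (graphOf A).degree v}

/-- `k` is a sharp threshold bias of the sequence of games `F`, where `n` tends to infinity along
the filter `l` (all `n`, or all even `n`). Biases are rounded down to natural numbers. -/
def IsSharpThresholdBias (l : Filter ℕ) (F : (n : ℕ) → Set (Set (KEdge n))) (k : ℕ → ℕ) : Prop :=
  ∀ ε : ℝ, 0 < ε →
    (∀ S : (n : ℕ) → Strategy (KEdge n),
      Tendsto (fun n => probBreakerWins (F n) ⌊(1 + ε) * (k n : ℝ)⌋₊ (S n)) l (𝓝 1)) ∧
    (∃ S : (n : ℕ) → Strategy (KEdge n),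
      Tendsto (fun n => probMakerWins (F n) ⌊(1 - ε) * (k n : ℝ)⌋₊ (S n)) l (𝓝 1))

/-- `n` tends to infinity through the even numbers. -/
def evenAtTop : Filter ℕ := atTop ⊓ 𝓟 {n | Even n}

end HalfRandom

end

/-! Above the threshold no randomness is needed. Against bias about `(1 + ε) n` Maker gets only
about `n / (2 (1 + ε))` edges in the whole game, too few to touch all `n` vertices
(`probBreakerWins_eq_one`).

Below the threshold let `k` be of order `log n` and `δ = ε / 2`, for a margin `ε < 1`. Maker needs
only `T = n / 2 + 1 + 2 k` moves, and after these rounds at most a proportion `1 - δ` of the board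
is occupied. Whatever Maker does, Breaker fills a given set of `w` edges by then with probability at
most `(1 - δ) ^ w` (`prob_exists_subset_breakerSet_le`, a supermartingale argument). A union bound
shows that, with probability tending to one, Breaker owns neither all edges between two disjoint
`k`-sets nor all but `3 k` of the edges at a vertex. Thus the graph of edges outside Breaker's set
is `WellConnected`.

Maker's progress is measured by a level: half the deficiency of a maximum matching, plus one if some
vertex is isolated. The second summand serves odd `n`, where a near-perfect matching may leave an
isolated vertex. In a well-connected graph a single edge lowers any level above `k`, since it can
join two uncovered vertices, and at most three edges lower any positive level, by an augmenting path
of length five. Maker always plays an edge of a smallest set that lowers the level. The first `n / 2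
+ 1 - k` moves then bring the level down to `k` without risk, and the remaining `3 k` moves bring it
to zero (`level_eq_zero`) unless Breaker hits one of the edges still to be played in the current
plan. The risk of that is `O(1 / n)` per round, hence `O(log n / n)` in total. The three failure
probabilities are added up in `prob_edgeLevel_ne_zero_le`. -/

noncomputable section

namespace HalfRandom

/-! ### Expectations under a probability mass function -/

/-- The expectation of a nonnegative function under a probability mass function. -/
def expect {α : Type} (p : PMF α) (φ : α → ℝ≥0∞) : ℝ≥0∞ := ∑' a, p a * φ a

section Expect

variable {α β : Type}

theorem expect_pure (x : α) (φ : α → ℝ≥0∞) : expect (PMF.pure x) φ = φ x := by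
  unfold expect
  rw [tsum_eq_single x]
  · simp
  · intro a ha
    simp [ha]

theorem expect_bind (p : PMF α) (f : α → PMF β) (φ : β → ℝ≥0∞) :
    expect (p.bind f) φ = expect p (fun a => expect (f a) φ) := by
  unfold expect
  simp only [PMF.bind_apply, ← ENNReal.tsum_mul_right, ← ENNReal.tsum_mul_left]
  rw [ENNReal.tsum_comm]
  simp only [mul_assoc]

theorem expect_uniform_map (s : Finset α) (hs : s.Nonempty) (g : α → β) (φ : β → ℝ≥0∞) :
    expect ((PMF.uniformOfFinset s hs).map g) φ = ∑ e ∈ s, (s.card : ℝ≥0∞)⁻¹ * φ (g e) := by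
  have : (PMF.uniformOfFinset s hs).map g
      = (PMF.uniformOfFinset s hs).bind (fun e => PMF.pure (g e)) := rfl
  rw [this, expect_bind]
  simp only [expect_pure]
  unfold expect
  rw [tsum_eq_sum (s := s)]
  · refine Finset.sum_congr rfl fun e he => ?_
    rw [PMF.uniformOfFinset_apply_of_mem hs he]
  · intro e he
    rw [PMF.uniformOfFinset_apply_of_notMem hs he, zero_mul]

theorem expect_mono {p : PMF α} {φ ψ : α → ℝ≥0∞} (h : ∀ a ∈ p.support, φ a ≤ ψ a) :
    expect p φ ≤ expect p ψ := by
  refine ENNReal.tsum_le_tsum fun a => ?_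
  by_cases ha : a ∈ p.support
  · gcongr
    exact h a ha
  · rw [PMF.mem_support_iff, not_not] at ha
    simp [ha]

theorem expect_congr {p : PMF α} {φ ψ : α → ℝ≥0∞} (h : ∀ a ∈ p.support, φ a = ψ a) :
    expect p φ = expect p ψ :=
  le_antisymm (expect_mono fun a ha => (h a ha).le) (expect_mono fun a ha => (h a ha).ge)

theorem expect_const (p : PMF α) (c : ℝ≥0∞) : expect p (fun _ => c) = c := by
  unfold expect
  rw [ENNReal.tsum_mul_right, p.tsum_coe, one_mul]

theorem toOuterMeasure_eq_expect (p : PMF α) (s : Set α) :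
    p.toOuterMeasure s = expect p (s.indicator 1) := by
  rw [PMF.toOuterMeasure_apply]
  unfold expect
  congr 1
  ext a
  by_cases ha : a ∈ s <;> simp [ha]

theorem toOuterMeasure_le_of_support (p : PMF α) {s t : Set α}
    (h : ∀ a ∈ p.support, a ∈ s → a ∈ t) : p.toOuterMeasure s ≤ p.toOuterMeasure t :=
  PMF.toOuterMeasure_mono p fun a ha => h a ha.2 ha.1

theorem one_le_toOuterMeasure_add_compl (p : PMF α) (s : Set α) :
    1 ≤ p.toOuterMeasure s + p.toOuterMeasure sᶜ := by
  have h1 : p.toOuterMeasure Set.univ = 1 := by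
    rw [PMF.toOuterMeasure_apply_eq_one_iff]
    exact Set.subset_univ _
  rw [← h1, ← Set.union_compl_self s]
  exact MeasureTheory.measure_union_le _ _

theorem toOuterMeasure_le_one (p : PMF α) (s : Set α) : p.toOuterMeasure s ≤ 1 := by
  have h1 : p.toOuterMeasure Set.univ = 1 := by
    rw [PMF.toOuterMeasure_apply_eq_one_iff]
    exact Set.subset_univ _
  rw [← h1]
  exact MeasureTheory.measure_mono (Set.subset_univ _)

end Expect

/-! ### Legal plays -/

section Plays

variable {E : Type}

/-- The elements that Breaker occupies in the play-sequence `h`. -/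
def breakerSet (b : ℕ) (h : List E) : Set E := {e | ∃ j, j % (b + 1) ≠ 0 ∧ h[j]? = some e}

/-- A play-sequence without repetitions in which Maker's moves follow `S`. -/
def Legal (b : ℕ) (S : Strategy E) (h : List E) : Prop :=
  h.Nodup ∧ ∀ i, i * (b + 1) < h.length →
    ∃ hf, h[i * (b + 1)]? = some (S.move (h.take (i * (b + 1))) hf)

theorem breakerSet_append (b : ℕ) (h : List E) (e : E) :
    breakerSet b (h ++ [e]) =
      if h.length % (b + 1) = 0 then breakerSet b h else insert e (breakerSet b h) := by
  ext x
  have key : ∀ j, (h ++ [e])[j]? = some x ↔ h[j]? = some x ∨ (j = h.length ∧ e = x) := by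
    intro j
    rcases lt_trichotomy j h.length with hj | hj | hj
    · rw [List.getElem?_append_left hj]
      constructor
      · exact Or.inl
      · rintro (h1 | h1)
        · exact h1
        · omega
    · subst hj
      simp
    · have h1 : h[j]? = none := by simp; omega
      have h2 : (h ++ [e])[j]? = none := by simp; omega
      rw [h1, h2]
      simp
      omega
  unfold breakerSet
  split_ifs with h0
  · simp only [Set.mem_ofPred_eq, key]
    constructor
    · rintro ⟨j, hj, h1 | ⟨h1, -⟩⟩
      · exact ⟨j, hj, h1⟩
      · subst h1; exact absurd h0 hj
    · rintro ⟨j, hj, h1⟩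
      exact ⟨j, hj, Or.inl h1⟩
  · simp only [Set.mem_ofPred_eq, key, Set.mem_insert_iff]
    constructor
    · rintro ⟨j, hj, h1 | ⟨-, h1⟩⟩
      · exact Or.inr ⟨j, hj, h1⟩
      · exact Or.inl h1.symm
    · rintro (h1 | ⟨j, hj, h1⟩)
      · exact ⟨h.length, h0, Or.inr ⟨rfl, h1.symm⟩⟩
      · exact ⟨j, hj, Or.inl h1⟩

theorem breakerSet_subset (b : ℕ) (h : List E) {e : E} (he : e ∈ breakerSet b h) : e ∈ h := by
  obtain ⟨j, -, hj⟩ := he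
  exact List.mem_of_getElem? hj

theorem breakerSet_take_subset (b : ℕ) (h : List E) {s t : ℕ} (hst : s ≤ t) :
    breakerSet b (h.take s) ⊆ breakerSet b (h.take t) := by
  rintro e ⟨j, hj, hje⟩
  refine ⟨j, hj, ?_⟩
  rw [List.getElem?_take] at hje ⊢
  split_ifs at hje with h1
  rw [if_pos (by omega), hje]

theorem exists_free_iff [Fintype E] {h : List E} (hn : h.Nodup) :
    (∃ e, e ∉ h) ↔ h.length < Fintype.card E := by
  classical
  rw [← List.toFinset_card_of_nodup hn, ← Finset.card_univ (α := E)]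
  constructor
  · rintro ⟨e, he⟩
    refine Finset.card_lt_card ⟨Finset.subset_univ _, fun hs => he ?_⟩
    simpa using hs (Finset.mem_univ e)
  · intro hlt
    obtain ⟨e, -, he⟩ := Finset.exists_mem_notMem_of_card_lt_card hlt
    exact ⟨e, by simpa using he⟩

theorem card_freeSet [Fintype E] {h : List E} (hn : h.Nodup) :
    (freeSet h).card = Fintype.card E - h.length := by
  classical
  have : freeSet h = h.toFinsetᶜ := by
    ext e
    simp [freeSet]
  rw [this, Finset.card_compl, List.toFinset_card_of_nodup hn]

theorem Legal.append {b : ℕ} {S : Strategy E} {h : List E} (hl : Legal b S h) {e : E}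
    (he : e ∉ h)
    (hm : h.length % (b + 1) = 0 → ∃ hf, e = S.move h hf) : Legal b S (h ++ [e]) := by
  refine ⟨?_, fun i hi => ?_⟩
  · rw [List.nodup_append]
    refine ⟨hl.1, List.nodup_singleton e, ?_⟩
    intro a ha c hc
    simp only [List.mem_singleton] at hc
    subst hc
    rintro rfl
    exact he ha
  · simp only [List.length_append, List.length_singleton] at hi
    rcases Nat.lt_or_ge (i * (b + 1)) h.length with h1 | h1
    · rw [List.getElem?_append_left h1, List.take_append_of_le_length h1.le]
      exact hl.2 i h1
    · have h2 : i * (b + 1) = h.length := by omega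
      obtain ⟨hf, hf'⟩ := hm (by rw [← h2]; simp)
      rw [h2]
      simp only [List.take_left']
      refine ⟨hf, ?_⟩
      simp [hf']

open Classical in
/-- The number of elements of `W` that Breaker does not occupy in the play-sequence `h`. -/
def missing (b : ℕ) (W : Finset E) (h : List E) : ℕ := (W.filter (fun e => e ∉ breakerSet b h)).card

theorem missing_eq_zero_iff {b : ℕ} {W : Finset E} {h : List E} :
    missing b W h = 0 ↔ ∀ e ∈ W, e ∈ breakerSet b h := by
  classical
  unfold missing
  rw [Finset.card_eq_zero, Finset.filter_eq_empty_iff]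
  simp

variable [Fintype E]

theorem mem_support_step {b : ℕ} {S : Strategy E} {h g : List E}
    (hg : g ∈ (step b S h).support) :
    ((∃ e, e ∉ h) ∧ ∃ e, e ∉ h ∧ g = h ++ [e] ∧ (h.length % (b + 1) = 0 → ∃ hf, e = S.move h hf)) ∨
      ((¬ ∃ e, e ∉ h) ∧ g = h) := by
  unfold step at hg
  split_ifs at hg with h1 h2
  · rw [PMF.support_pure] at hg
    exact Or.inl ⟨h1, _, S.move_free h h1, hg, fun _ => ⟨h1, rfl⟩⟩
  · rw [PMF.support_map] at hg
    obtain ⟨e, he, rfl⟩ := hg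
    rw [PMF.support_uniformOfFinset] at he
    simp only [freeSet, Finset.coe_filter, Finset.mem_univ, true_and, Set.mem_ofPred_eq] at he
    exact Or.inl ⟨h1, e, he, rfl, fun h3 => absurd h3 h2⟩
  · rw [PMF.support_pure] at hg
    exact Or.inr ⟨h1, hg⟩

theorem legal_of_mem_support {b : ℕ} {S : Strategy E} {m : ℕ} {h : List E}
    (hh : h ∈ (playAfter b S m).support) :
    Legal b S h ∧ h.length = min m (Fintype.card E) := by
  induction m generalizing h with
  | zero =>
    simp only [playAfter, PMF.support_pure, Set.mem_singleton_iff] at hh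
    subst hh
    exact ⟨⟨List.nodup_nil, fun i hi => by simp at hi⟩, by simp⟩
  | succ m ih =>
    simp only [playAfter, PMF.mem_support_bind_iff] at hh
    obtain ⟨g, hg, hgh⟩ := hh
    obtain ⟨hl, hlen⟩ := ih hg
    rcases mem_support_step hgh with ⟨hf, e, he, rfl, hm⟩ | ⟨hf, rfl⟩
    · refine ⟨hl.append he hm, ?_⟩
      rw [exists_free_iff hl.1] at hf
      simp only [List.length_append, List.length_singleton]
      omega
    · refine ⟨hl, ?_⟩
      rw [exists_free_iff hl.1] at hf
      omega

/-- Moves only append to the sequence. This transfers bounds on events at time `m` to the law of the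
whole game. -/
theorem expect_playAfter_take {b : ℕ} {S : Strategy E} {m M : ℕ} (hmM : m ≤ M)
    (hM : M ≤ Fintype.card E) (φ : List E → ℝ≥0∞) :
    expect (playAfter b S M) (fun h => φ (h.take m)) = expect (playAfter b S m) φ := by
  induction M, hmM using Nat.le_induction with
  | base =>
    refine expect_congr fun h hh => ?_
    rw [List.take_of_length_le]
    have := (legal_of_mem_support hh).2
    omega
  | succ M hmM ih =>
    rw [← ih (by omega)]
    simp only [playAfter]
    rw [expect_bind]
    refine expect_congr fun h hh => ?_
    have hlen := (legal_of_mem_support hh).2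
    rw [← expect_const (step b S h) (φ (h.take m))]
    refine expect_congr fun g hg => ?_
    rcases mem_support_step hg with ⟨hf, e, he, rfl, hm⟩ | ⟨hf, rfl⟩
    · rw [List.take_append_of_le_length (by omega)]
    · rfl

/-! ### Breaker rarely occupies a given set -/

/-- The first two terms of the binomial expansion; the others are nonnegative. -/
theorem pow_add_mul_le_add_pow {x y : ℝ} (hx : 0 ≤ x) (hy : 0 ≤ y) (w : ℕ) :
    x ^ (w + 1) + (w + 1) * (y * x ^ w) ≤ (x + y) ^ (w + 1) := by
  induction w with
  | zero => simp
  | succ w ih =>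
    have h1 := mul_le_mul_of_nonneg_right ih (add_nonneg hx hy)
    have h2 : 0 ≤ (w + 1 : ℝ) * (y * x ^ w) * y := by positivity
    rw [pow_succ (x + y)]
    refine le_trans ?_ h1
    push_cast
    have e1 : x ^ (w + 1 + 1) + ((w:ℝ) + 1 + 1) * (y * x ^ (w + 1)) + (w + 1 : ℝ) * (y * x ^ w) * y
      = (x ^ (w + 1) + (↑w + 1) * (y * x ^ w)) * (x + y) := by ring
    linarith

/-- The chance that a single element, free at time `t`, is taken before time `m` in a sequence of
uniformly random moves on a board with `N` elements. -/
def hitRatio (N m t : ℕ) : ℝ := ((m : ℝ) - t) / ((N : ℝ) - t)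

theorem hitRatio_nonneg {N m t : ℕ} (h1 : t ≤ m) (h2 : m ≤ N) : 0 ≤ hitRatio N m t := by
  unfold hitRatio
  have h1' : (t : ℝ) ≤ m := by exact_mod_cast h1
  have h2' : (m : ℝ) ≤ N := by exact_mod_cast h2
  exact div_nonneg (by linarith) (by linarith)

theorem hitRatio_le_one {N m t : ℕ} (h1 : t ≤ m) (h2 : m ≤ N) : hitRatio N m t ≤ 1 := by
  unfold hitRatio
  have h1' : (t : ℝ) ≤ m := by exact_mod_cast h1
  have h2' : (m : ℝ) ≤ N := by exact_mod_cast h2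
  exact div_le_one_of_le₀ (by linarith) (by linarith)

/-- A free element is taken at once with probability `1 / (N - t)`, and otherwise it still has the
later chance. -/
theorem hitRatio_succ {N m t : ℕ} (h1 : t < m) (h2 : m ≤ N) :
    hitRatio N m t
      = hitRatio N m (t + 1) + (1 - hitRatio N m (t + 1)) / ((N : ℝ) - t) := by
  unfold hitRatio
  have h1' : (t : ℝ) + 1 ≤ m := by exact_mod_cast h1
  have h2' : (m : ℝ) ≤ N := by exact_mod_cast h2
  have h3 : (N : ℝ) - t ≠ 0 := by linarith
  push_cast
  -- If `t + 1 = N`, then `m = N` and the later ratio is `0 / 0 = 0`; the recursion survives because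
  -- `N - t = 1`.
  rcases eq_or_lt_of_le (by linarith : (t : ℝ) + 1 ≤ N) with h4 | h4
  · have h5 : (m : ℝ) = N := by linarith
    have h6 : (N : ℝ) - (t + 1) = 0 := by linarith
    rw [h5, h6, div_zero, sub_zero, zero_add, div_self h3, ← h4]
    simp
  · have h6 : (N : ℝ) - (t + 1) ≠ 0 := by linarith
    field_simp
    ring

/-- The supermartingale behind all probability bounds: with `q` the current hit ratio, `q ^ missing`
dominates the chance that Breaker completes `W` by time `m`, as if the missing elements were hit
independently. A move of Maker leaves `missing` unchanged while the ratio falls; a move of Breaker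
is handled by the truncated binomial inequality. -/
theorem expect_step_missing_le {b : ℕ} {S : Strategy E} {h : List E} (hn : h.Nodup) {m : ℕ}
    (hm : h.length < m) (hmN : m ≤ Fintype.card E) (W : Finset E) :
    expect (step b S h)
        (fun g => ENNReal.ofReal (hitRatio (Fintype.card E) m (h.length + 1) ^ missing b W g))
      ≤ ENNReal.ofReal (hitRatio (Fintype.card E) m h.length ^ missing b W h) := by
  classical
  set N := Fintype.card E with hN
  set q' := hitRatio N m (h.length + 1) with hq'
  set q := hitRatio N m h.length with hq
  have hq0 : 0 ≤ q' := hitRatio_nonneg hm hmN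
  have hq1 : q' ≤ 1 := hitRatio_le_one hm hmN
  have hrec : q = q' + (1 - q') / ((N : ℝ) - h.length) := hitRatio_succ hm hmN
  have hfpos : (0 : ℝ) < (N : ℝ) - h.length := by
    have : (h.length : ℝ) < N := by exact_mod_cast lt_of_lt_of_le hm hmN
    linarith
  have hqq : q' ≤ q := by
    rw [hrec]
    have : 0 ≤ (1 - q') / ((N : ℝ) - h.length) := div_nonneg (by linarith) hfpos.le
    linarith
  have hf : ∃ e, e ∉ h := (exists_free_iff hn).2 (lt_of_lt_of_le hm hmN)
  unfold step
  rw [dif_pos hf]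
  split_ifs with h0
  · rw [expect_pure]
    have : missing b W (h ++ [S.move h hf]) = missing b W h := by
      unfold missing
      rw [breakerSet_append, if_pos h0]
    rw [this]
    exact ENNReal.ofReal_le_ofReal (pow_le_pow_left₀ hq0 hqq _)
  · rw [expect_uniform_map]
    have hcard : ((freeSet h).card : ℝ) = (N : ℝ) - h.length := by
      rw [card_freeSet hn, Nat.cast_sub (lt_of_lt_of_le hm hmN).le]
    have hinv : ((freeSet h).card : ℝ≥0∞)⁻¹ = ENNReal.ofReal ((N : ℝ) - h.length)⁻¹ := by
      rw [ENNReal.ofReal_inv_of_pos hfpos, ← hcard, ENNReal.ofReal_natCast]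
    set W' := W.filter (fun e => e ∉ breakerSet b h) with hW'
    have hmiss : ∀ e ∈ freeSet h, missing b W (h ++ [e]) =
        if e ∈ W' then W'.card - 1 else W'.card := by
      intro e _
      have : W.filter (fun x => x ∉ breakerSet b (h ++ [e])) = W'.erase e := by
        ext x
        rw [breakerSet_append, if_neg h0]
        simp only [hW', Finset.mem_filter, Set.mem_insert_iff, Finset.mem_erase]
        tauto
      unfold missing
      rw [this]
      split_ifs with h1
      · rw [Finset.card_erase_of_mem h1]
      · rw [Finset.erase_eq_of_notMem h1]
    have hW0 : missing b W h = W'.card := rfl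
    rw [hinv, hW0]
    have hsum : ∑ e ∈ freeSet h, ENNReal.ofReal ((N : ℝ) - h.length)⁻¹ *
          ENNReal.ofReal (q' ^ missing b W (h ++ [e]))
        = ENNReal.ofReal (∑ e ∈ freeSet h, ((N : ℝ) - h.length)⁻¹ *
          (if e ∈ W' then q' ^ (W'.card - 1) else q' ^ W'.card)) := by
      rw [ENNReal.ofReal_sum_of_nonneg]
      · refine Finset.sum_congr rfl fun e he => ?_
        rw [hmiss e he, ENNReal.ofReal_mul (by positivity)]
        split_ifs <;> rfl
      · intro e _
        have := inv_nonneg.2 hfpos.le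
        split_ifs <;> positivity
    rw [hsum]
    refine ENNReal.ofReal_le_ofReal ?_
    rw [← Finset.mul_sum, Finset.sum_ite, Finset.sum_const, Finset.sum_const, nsmul_eq_mul,
      nsmul_eq_mul]
    -- Missing elements that Maker owns can no longer be taken, so `c` may be smaller than
    -- `W'.card`; only `c ≤ W'.card` is needed.
    set c := ((freeSet h).filter (fun e => e ∈ W')).card with hc
    have hcW : c ≤ W'.card := Finset.card_le_card fun e he => (Finset.mem_filter.1 he).2
    have hsplit : (c : ℝ) + ((freeSet h).filter (fun e => e ∉ W')).card
        = (N : ℝ) - h.length := by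
      rw [← hcard, ← Finset.card_filter_add_card_filter_not (s := freeSet h) (fun e => e ∈ W')]
      push_cast
      rfl
    have hd : (((freeSet h).filter (fun e => e ∉ W')).card : ℝ) = (N : ℝ) - h.length - c := by
      linarith
    rw [hd]
    -- The exponent `W'.card - 1` is truncated at zero, so a completed set is treated apart.
    rcases Nat.eq_zero_or_pos W'.card with hw | hw
    · have hc0 : c = 0 := by omega
      rw [hw, hc0]
      simp [hfpos.ne']
    · obtain ⟨w, hw⟩ : ∃ w, W'.card = w + 1 := ⟨W'.card - 1, by omega⟩
      rw [hw] at hcW ⊢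
      have hb := pow_add_mul_le_add_pow hq0
        (div_nonneg (by linarith : 0 ≤ 1 - q') hfpos.le) w
      rw [← hrec] at hb
      refine le_trans ?_ hb
      have hcw : (c : ℝ) ≤ w + 1 := by exact_mod_cast hcW
      have e1 : ((N : ℝ) - h.length)⁻¹ *
          (c * q' ^ (w + 1 - 1) + ((N : ℝ) - h.length - c) * q' ^ (w + 1))
          = q' ^ (w + 1) + c * ((1 - q') / ((N : ℝ) - h.length) * q' ^ w) := by
        rw [Nat.add_sub_cancel]
        field_simp
        ring
      rw [e1]
      have : 0 ≤ (1 - q') / ((N : ℝ) - h.length) * q' ^ w :=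
        mul_nonneg (div_nonneg (by linarith) hfpos.le) (by positivity)
      gcongr

/-- The index set is frozen at time `s`, so the one-step bound sums termwise. The dependence on the
history is needed for Maker's current plan, which is known only when the round begins. -/
theorem expect_sum_missing_le {b : ℕ} {S : Strategy E} {ι : Type} (I : List E → Finset ι)
    (W : ι → Finset E) {s m : ℕ} (hsm : s ≤ m) (hmN : m ≤ Fintype.card E) :
    expect (playAfter b S m) (fun h => ∑ i ∈ I (h.take s),
        ENNReal.ofReal (hitRatio (Fintype.card E) m m ^ missing b (W i) h))
      ≤ expect (playAfter b S s) (fun h => ∑ i ∈ I h,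
        ENNReal.ofReal (hitRatio (Fintype.card E) m s ^ missing b (W i) h)) := by
  suffices H : ∀ t, s ≤ t → t ≤ m →
      expect (playAfter b S t) (fun h => ∑ i ∈ I (h.take s),
        ENNReal.ofReal (hitRatio (Fintype.card E) m t ^ missing b (W i) h))
      ≤ expect (playAfter b S s) (fun h => ∑ i ∈ I h,
        ENNReal.ofReal (hitRatio (Fintype.card E) m s ^ missing b (W i) h)) from H m hsm le_rfl
  intro t hst
  induction t, hst using Nat.le_induction with
  | base =>
    intro _
    refine expect_mono fun h hh => ?_
    rw [List.take_of_length_le]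
    have := (legal_of_mem_support hh).2
    omega
  | succ t hst ih =>
    intro htm
    refine le_trans ?_ (ih (by omega))
    simp only [playAfter]
    rw [expect_bind]
    refine expect_mono fun h hh => ?_
    obtain ⟨hl, hlen⟩ := legal_of_mem_support hh
    have hlen' : h.length = t := by omega
    have h1 : expect (step b S h) (fun g => ∑ i ∈ I (g.take s),
          ENNReal.ofReal (hitRatio (Fintype.card E) m (t + 1) ^ missing b (W i) g))
        = expect (step b S h) (fun g => ∑ i ∈ I (h.take s),
          ENNReal.ofReal (hitRatio (Fintype.card E) m (t + 1) ^ missing b (W i) g)) := by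
      refine expect_congr fun g hg => ?_
      rcases mem_support_step hg with ⟨hf, e, he, rfl, hm⟩ | ⟨hf, rfl⟩
      · rw [List.take_append_of_le_length (by omega)]
      · rfl
    rw [h1]
    unfold expect
    simp only [Finset.mul_sum]
    rw [Summable.tsum_finsetSum fun _ _ => ENNReal.summable]
    refine Finset.sum_le_sum fun i _ => ?_
    have h2 := expect_step_missing_le (b := b) (S := S) hl.1 (m := m) (by omega) hmN (W i)
    rw [hlen'] at h2
    exact h2

/-- If the sets with an index in `I h` are all unlikely to be completed by Breaker, given the play
`h` up to time `s`, then it is unlikely that Breaker has completed one of them at time `m`. -/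
theorem prob_exists_subset_breakerSet_le {b : ℕ} {S : Strategy E} {ι : Type}
    (I : List E → Finset ι) (W : ι → Finset E) {s m : ℕ} (hsm : s ≤ m)
    (hmN : m ≤ Fintype.card E) {c : ℝ}
    (hc : ∀ h : List E, h.length = s →
      ∑ i ∈ I h, hitRatio (Fintype.card E) m s ^ missing b (W i) h ≤ c) :
    (play b S).toOuterMeasure
        {γ | ∃ i ∈ I (γ.take s), ∀ e ∈ W i, e ∈ breakerSet b (γ.take m)} ≤ ENNReal.ofReal c := by
  rw [toOuterMeasure_eq_expect]
  calc expect (play b S) (Set.indicator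
          {γ | ∃ i ∈ I (γ.take s), ∀ e ∈ W i, e ∈ breakerSet b (γ.take m)} 1)
      = expect (play b S) (fun γ => Set.indicator
          {γ | ∃ i ∈ I (γ.take s), ∀ e ∈ W i, e ∈ breakerSet b γ} 1 (γ.take m)) := by
        congr 1
        ext γ
        have : γ ∈ {γ | ∃ i ∈ I (γ.take s), ∀ e ∈ W i, e ∈ breakerSet b (γ.take m)} ↔
            γ.take m ∈ {γ | ∃ i ∈ I (γ.take s), ∀ e ∈ W i, e ∈ breakerSet b γ} := by
          simp only [Set.mem_ofPred_eq, List.take_take, min_eq_left hsm]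
        by_cases hx : γ.take m ∈ {γ | ∃ i ∈ I (γ.take s), ∀ e ∈ W i, e ∈ breakerSet b γ}
        · rw [Set.indicator_of_mem hx, Set.indicator_of_mem (this.2 hx)]
          rfl
        · rw [Set.indicator_of_notMem hx, Set.indicator_of_notMem (fun h => hx (this.1 h))]
    _ = expect (playAfter b S m) (Set.indicator
          {γ | ∃ i ∈ I (γ.take s), ∀ e ∈ W i, e ∈ breakerSet b γ} 1) :=
        expect_playAfter_take hmN le_rfl _
    _ ≤ expect (playAfter b S m) (fun h => ∑ i ∈ I (h.take s),
          ENNReal.ofReal (hitRatio (Fintype.card E) m m ^ missing b (W i) h)) := by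
        refine expect_mono fun h _ => ?_
        refine Set.indicator_apply_le' ?_ fun _ => zero_le
        rintro ⟨i, hi, hW⟩
        refine le_trans ?_ (Finset.single_le_sum (f := fun i => ENNReal.ofReal
          (hitRatio (Fintype.card E) m m ^ missing b (W i) h)) (fun _ _ => zero_le) hi)
        -- A completed set has nothing missing, so its summand is a zeroth power, which is one.
        simp [missing_eq_zero_iff.2 hW]
    _ ≤ expect (playAfter b S s) (fun h => ∑ i ∈ I h,
          ENNReal.ofReal (hitRatio (Fintype.card E) m s ^ missing b (W i) h)) :=
        expect_sum_missing_le I W hsm hmN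
    _ ≤ expect (playAfter b S s) (fun _ => ENNReal.ofReal c) := by
        refine expect_mono fun h hh => ?_
        have hlen := (legal_of_mem_support hh).2
        rw [← ENNReal.ofReal_sum_of_nonneg fun _ _ => pow_nonneg (hitRatio_nonneg hsm hmN) _]
        exact ENNReal.ofReal_le_ofReal (hc h (by omega))
    _ = ENNReal.ofReal c := expect_const _ _

end Plays

/-! ### A positional strategy of Maker -/

section Planning

variable {E : Type}

theorem makerSet_take (b t : ℕ) (γ : List E) :
    makerSet b (γ.take (t * (b + 1))) = makerAfter b t γ := by
  ext e
  simp only [makerSet, makerAfter, Set.mem_ofPred_eq]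
  refine exists_congr fun i => ?_
  rw [List.getElem?_take]
  split_ifs with h
  · simp [Nat.lt_of_mul_lt_mul_right h]
  · have : ¬ i < t := fun h' => h (Nat.mul_lt_mul_of_pos_right h' (Nat.succ_pos b))
    simp [this]

theorem mem_makerSet_or_mem_breakerSet (b : ℕ) {h : List E} {e : E} (he : e ∈ h) :
    e ∈ makerSet b h ∨ e ∈ breakerSet b h := by
  obtain ⟨j, hj⟩ := List.mem_iff_getElem?.1 he
  by_cases h0 : j % (b + 1) = 0
  · refine Or.inl ⟨j / (b + 1), ?_⟩
    rw [Nat.div_mul_cancel (Nat.dvd_of_mod_eq_zero h0)]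
    exact hj
  · exact Or.inr ⟨j, h0, hj⟩

/-- Occupying all of `P`, which is still free, would lower the level `L` of Maker's set. -/
def Advances (b : ℕ) (L : Set E → ℕ) (h : List E) (P : Finset E) : Prop :=
  (∀ e ∈ P, e ∉ h) ∧ L (makerSet b h ∪ P) < L (makerSet b h)

theorem exists_advances_min {b : ℕ} {L : Set E → ℕ} {h : List E}
    (hx : ∃ P, Advances b L h P) :
    ∃ P, Advances b L h P ∧ ∀ Q, Advances b L h Q → P.card ≤ Q.card := by
  obtain ⟨P, hP, hmin⟩ := (measure (Finset.card : Finset E → ℕ)).wf.has_min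
    {P | Advances b L h P} hx
  exact ⟨P, hP, fun Q hQ => not_lt.1 (hmin Q hQ)⟩

open Classical in
/-- A smallest set of free elements that lowers the level of Maker's set. -/
def plan (b : ℕ) (L : Set E → ℕ) (h : List E) : Finset E :=
  if hx : ∃ P, Advances b L h P then (exists_advances_min hx).choose else ∅

theorem plan_spec {b : ℕ} {L : Set E → ℕ} {h : List E} {P : Finset E}
    (hP : Advances b L h P) :
    Advances b L h (plan b L h) ∧ (plan b L h).card ≤ P.card := by
  have hx : ∃ P, Advances b L h P := ⟨P, hP⟩
  unfold plan
  rw [dif_pos hx]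
  have := (exists_advances_min hx).choose_spec
  exact ⟨this.1, this.2 P hP⟩

theorem Advances.nonempty {b : ℕ} {L : Set E → ℕ} {h : List E} {P : Finset E}
    (hP : Advances b L h P) : P.Nonempty := by
  rw [Finset.nonempty_iff_ne_empty]
  rintro rfl
  have := hP.2
  simp at this

theorem plan_free {b : ℕ} {L : Set E → ℕ} {h : List E} {e : E} (he : e ∈ plan b L h) :
    e ∉ h := by
  unfold plan at he
  split_ifs at he with hx
  · exact (exists_advances_min hx).choose_spec.1.1 e he
  · simp at he

open Classical in
/-- Maker occupies an element of a smallest set that lowers the level. -/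
def planStrategy (b : ℕ) (L : Set E → ℕ) : Strategy E where
  move h hf := if hp : (plan b L h).Nonempty then hp.choose else hf.choose
  move_free h hf := by
    split_ifs with hp
    · exact plan_free hp.choose_spec
    · exact hf.choose_spec

theorem planStrategy_move_mem {b : ℕ} {L : Set E → ℕ} {h : List E} (hf : ∃ e, e ∉ h)
    (hp : (plan b L h).Nonempty) : (planStrategy b L).move h hf ∈ plan b L h := by
  simp only [planStrategy, dif_pos hp]
  exact hp.choose_spec

open Classical in
/-- The elements of a small plan that Maker leaves to his later moves. -/
def pending (b : ℕ) (L : Set E → ℕ) (h : List E) : Finset E :=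
  if (plan b L h).card ≤ 3 then
    (plan b L h).filter (fun e => ∀ hf, e ≠ (planStrategy b L).move h hf)
  else ∅

theorem card_pending_le (b : ℕ) (L : Set E → ℕ) (h : List E) : (pending b L h).card ≤ 3 := by
  classical
  unfold pending
  split_ifs with h3
  · exact (Finset.card_filter_le _ _).trans h3
  · simp

theorem pending_free {b : ℕ} {L : Set E → ℕ} {h : List E} {e : E} (he : e ∈ pending b L h) :
    e ∉ h := by
  classical
  unfold pending at he
  split_ifs at he
  · exact plan_free (Finset.mem_filter.1 he).1
  · simp at he

theorem makerAfter_succ {b : ℕ} {S : Strategy E} {γ : List E} {i : ℕ}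
    {hf : ∃ e, e ∉ γ.take (i * (b + 1))}
    (h : γ[i * (b + 1)]? = some (S.move (γ.take (i * (b + 1))) hf)) :
    makerAfter b (i + 1) γ = insert (S.move (γ.take (i * (b + 1))) hf) (makerAfter b i γ) := by
  ext e
  simp only [makerAfter, Set.mem_ofPred_eq, Set.mem_insert_iff]
  constructor
  · rintro ⟨j, hj, hje⟩
    rcases Nat.lt_succ_iff_lt_or_eq.1 hj with h1 | rfl
    · exact Or.inr ⟨j, h1, hje⟩
    · rw [h] at hje
      exact Or.inl (Option.some_injective _ hje).symm
  · rintro (rfl | ⟨j, hj, hje⟩)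
    · exact ⟨i, Nat.lt_succ_self i, h⟩
    · exact ⟨j, Nat.lt_succ_of_lt hj, hje⟩

theorem makerAfter_mono (b : ℕ) (γ : List E) {s t : ℕ} (hst : s ≤ t) :
    makerAfter b s γ ⊆ makerAfter b t γ :=
  fun _ ⟨i, hi, h⟩ => ⟨i, hi.trans_le hst, h⟩

theorem makerAfter_subset_makerSet (b t : ℕ) (γ : List E) :
    makerAfter b t γ ⊆ makerSet b γ :=
  fun _ ⟨i, _, h⟩ => ⟨i, h⟩

/-- What Breaker does not own is free or already Maker's. Discarding the latter part of `P` leaves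
its union with Maker's set unchanged. -/
theorem exists_advances_of_disjoint {b : ℕ} {L : Set E → ℕ} {h : List E} {P : Finset E}
    (hP : ∀ e ∈ P, e ∉ breakerSet b h) (hL : L (makerSet b h ∪ P) < L (makerSet b h)) :
    ∃ Q : Finset E, Q.card ≤ P.card ∧ Advances b L h Q := by
  classical
  refine ⟨P.filter (fun e => e ∉ makerSet b h), Finset.card_filter_le _ _, ?_, ?_⟩
  · intro e he hh
    rw [Finset.mem_filter] at he
    rcases mem_makerSet_or_mem_breakerSet b hh with h1 | h1
    · exact he.2 h1
    · exact hP e he.1 h1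
  · convert hL using 2
    ext e
    simp only [Finset.coe_filter, Set.mem_union, Set.mem_ofPred_eq, Finset.mem_coe]
    tauto

theorem plan_card_le_of_disjoint {b : ℕ} {L : Set E → ℕ} {h : List E} {P : Finset E}
    (hP : ∀ e ∈ P, e ∉ breakerSet b h) (hL : L (makerSet b h ∪ P) < L (makerSet b h)) :
    Advances b L h (plan b L h) ∧ (plan b L h).card ≤ P.card := by
  obtain ⟨Q, hQ, hadv⟩ := exists_advances_of_disjoint hP hL
  exact ⟨(plan_spec hadv).1, (plan_spec hadv).2.trans hQ⟩

/-- If Breaker does not interfere with the plan, then one move of Maker either lowers the level or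
shortens the plan. -/
theorem plan_progress {b : ℕ} {L : Set E → ℕ} (hL : Antitone L) {γ : List E}
    (hγ : Legal b (planStrategy b L) γ) {i : ℕ} (hi : i * (b + 1) < γ.length)
    (hadv : Advances b L (γ.take (i * (b + 1))) (plan b L (γ.take (i * (b + 1)))))
    (hcard : (plan b L (γ.take (i * (b + 1)))).card ≤ 3)
    (hpend : ∀ e ∈ pending b L (γ.take (i * (b + 1))),
      e ∉ breakerSet b (γ.take ((i + 1) * (b + 1)))) :
    L (makerAfter b (i + 1) γ) < L (makerAfter b i γ) ∨
      (plan b L (γ.take ((i + 1) * (b + 1)))).card < (plan b L (γ.take (i * (b + 1)))).card := by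
  classical
  by_cases hlt : L (makerAfter b (i + 1) γ) < L (makerAfter b i γ)
  · exact Or.inl hlt
  right
  obtain ⟨hf, hmove⟩ := hγ.2 i hi
  have hsucc := makerAfter_succ hmove
  have hmem := planStrategy_move_mem hf hadv.nonempty
  set h := γ.take (i * (b + 1)) with hh
  set P := plan b L h with hPdef
  set e := (planStrategy b L).move h hf with he
  have heq : L (makerAfter b (i + 1) γ) = L (makerAfter b i γ) :=
    le_antisymm (hL (makerAfter_mono b γ (Nat.le_succ i))) (not_lt.1 hlt)
  have hlt' := hadv.2
  rw [hh, makerSet_take] at hlt'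
  have hcov : makerAfter b (i + 1) γ ∪ ((P.erase e : Finset E) : Set E)
      = makerAfter b i γ ∪ (P : Set E) := by
    rw [hsucc]
    ext x
    simp only [Finset.coe_erase, Set.mem_union, Set.mem_insert_iff, Set.mem_sdiff,
      Finset.mem_coe, Set.mem_singleton_iff]
    by_cases hx : x = e
    · subst hx; simp [hmem]
    · simp [hx]
  have key : Advances b L (γ.take ((i + 1) * (b + 1)))
      (plan b L (γ.take ((i + 1) * (b + 1)))) ∧
      (plan b L (γ.take ((i + 1) * (b + 1)))).card ≤ (P.erase e).card := by
    -- Breaker has missed `P.erase e`, and together with Maker's move it makes up the old plan; the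
    -- level being unchanged, it still lowers the level and bounds the size of the new plan.
    refine plan_card_le_of_disjoint (fun x hx => hpend x ?_) ?_
    · unfold pending
      rw [if_pos hcard, Finset.mem_filter]
      rw [Finset.mem_erase] at hx
      exact ⟨hx.2, fun _ => hx.1⟩
    · rw [makerSet_take, hcov, heq]
      exact hlt'
  refine key.2.trans_lt ?_
  exact Finset.card_erase_lt_of_mem hmem

/-- If one element outside `X` suffices to lower levels above `s`, and three elements outside `X`
suffice to lower a positive level, then Maker brings the level down to zero in the first
`L ∅ + 2 s` moves, provided that Breaker stays inside `X` and does not interfere with Maker's plans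
once `L ∅ - s` moves are made. -/
theorem level_eq_zero {b : ℕ} {L : Set E → ℕ} (hL : Antitone L) {s T : ℕ} (hs : s ≤ L ∅)
    (hT : L ∅ + 2 * s ≤ T) {γ : List E} (hγ : Legal b (planStrategy b L) γ)
    (hlen : T * (b + 1) ≤ γ.length)
    (h1 : ∀ A, s < L A → ∃ e, e ∉ breakerSet b (γ.take (T * (b + 1))) ∧ L (insert e A) < L A)
    (h3 : ∀ A, 0 < L A → ∃ P : Finset E, P.card ≤ 3 ∧
      (∀ e ∈ P, e ∉ breakerSet b (γ.take (T * (b + 1)))) ∧ L (A ∪ P) < L A)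
    (hpend : ∀ i, L ∅ - s ≤ i → i < T → ∀ e ∈ pending b L (γ.take (i * (b + 1))),
      e ∉ breakerSet b (γ.take ((i + 1) * (b + 1)))) :
    L (makerAfter b T γ) = 0 := by
  classical
  -- Breaker's set only grows, so elements outside its final value were available in every earlier
  -- round; one event at time `T * (b + 1)` controls them all.
  have hXsub : ∀ i ≤ T, breakerSet b (γ.take (i * (b + 1)))
      ⊆ breakerSet b (γ.take (T * (b + 1))) :=
    fun i hi => breakerSet_take_subset b γ (Nat.mul_le_mul_right _ hi)
  have hpos : ∀ i < T, i * (b + 1) < γ.length :=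
    fun i hi => (Nat.mul_lt_mul_of_pos_right hi (Nat.succ_pos b)).trans_le hlen
  have hplan : ∀ i ≤ T, 0 < L (makerAfter b i γ) →
      Advances b L (γ.take (i * (b + 1))) (plan b L (γ.take (i * (b + 1)))) ∧
      (plan b L (γ.take (i * (b + 1)))).card ≤ 3 := by
    intro i hi hLi
    obtain ⟨P, hPc, hPX, hPL⟩ := h3 _ hLi
    rw [← makerSet_take] at hPL
    have := plan_card_le_of_disjoint (fun e he hb => hPX e he (hXsub i hi hb)) hPL
    exact ⟨this.1, this.2.trans hPc⟩
  have hmono : ∀ i, L (makerAfter b (i + 1) γ) ≤ L (makerAfter b i γ) :=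
    fun i => hL (makerAfter_mono b γ (Nat.le_succ i))
  -- Above level `s` a smallest plan is a singleton, completed by Maker's move before Breaker can
  -- react.
  have hfirst : ∀ i, i ≤ L ∅ - s → L (makerAfter b i γ) + i ≤ L ∅ := by
    intro i
    induction i with
    | zero =>
      intro _
      have : makerAfter b 0 γ = ∅ := by
        ext e
        simp [makerAfter]
      rw [this]
      simp
    | succ i ih =>
      intro hi
      have hi' := ih (by omega)
      have hm := hmono i
      rcases Nat.lt_or_ge s (L (makerAfter b i γ)) with hsl | hsl
      · suffices L (makerAfter b (i + 1) γ) < L (makerAfter b i γ) by omega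
        obtain ⟨e, heX, heL⟩ := h1 _ hsl
        rw [← makerSet_take] at heL
        have hk := plan_card_le_of_disjoint (b := b) (L := L) (h := γ.take (i * (b + 1)))
          (P := {e}) (fun x hx hb => by
            rw [Finset.mem_singleton] at hx
            subst hx
            exact heX (hXsub i (by omega) hb)) (by
            rw [Finset.coe_singleton, Set.union_comm, ← Set.insert_eq]
            exact heL)
        obtain ⟨hf, hmove⟩ := hγ.2 i (hpos i (by omega))
        have hsucc := makerAfter_succ hmove
        have hmem := planStrategy_move_mem hf hk.1.nonempty
        rw [Finset.card_singleton] at hk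
        have hPe : plan b L (γ.take (i * (b + 1)))
            = {(planStrategy b L).move (γ.take (i * (b + 1))) hf} :=
          Finset.eq_singleton_iff_unique_mem.2
            ⟨hmem, fun x hx => Finset.card_le_one.1 hk.2 _ hx _ hmem⟩
        have := hk.1.2
        rw [hPe, Finset.coe_singleton, Set.union_comm, ← Set.insert_eq, makerSet_take,
          ← hsucc] at this
        exact this
      · omega
  -- The quantity three times the level plus the plan size falls by at least one per round: either
  -- the plan shrinks, or the level drops, which gains three, while the plan size grows by at most
  -- two, from at least one to at most three. It starts at no more than `3 * s + 3` and is at least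
  -- four while the level is positive, so `3 * s` rounds suffice.
  have hsecond : ∀ j, L ∅ - s + j ≤ T → 0 < L (makerAfter b (L ∅ - s + j) γ) →
      3 * L (makerAfter b (L ∅ - s + j) γ)
        + (plan b L (γ.take ((L ∅ - s + j) * (b + 1)))).card + j ≤ 3 * s + 3 := by
    intro j
    induction j with
    | zero =>
      intro hj hLj
      have a1 := hfirst (L ∅ - s) le_rfl
      have a2 := (hplan _ hj hLj).2
      simp only [add_zero] at a2 hLj ⊢
      omega
    | succ j ih =>
      intro hj hLj
      rw [← add_assoc (L ∅ - s) j 1] at hj hLj ⊢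
      set i := L ∅ - s + j with hi
      have hm := hmono i
      have hih := ih (by omega) (by omega)
      have hp := hplan i (by omega) (by omega)
      have hp' := hplan (i + 1) hj hLj
      have hpr := plan_progress hL hγ (hpos i (by omega)) hp.1 hp.2
        (hpend i (by omega) (by omega))
      have hne := Finset.card_pos.2 hp.1.nonempty
      rcases hpr with hpr | hpr
      · omega
      · omega
  by_contra hne
  have hTpos : 0 < L (makerAfter b T γ) := Nat.pos_of_ne_zero hne
  have hj : L ∅ - s + (T - (L ∅ - s)) = T := by omega
  have := hsecond (T - (L ∅ - s)) (by omega) (by rw [hj]; exact hTpos)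
  rw [hj] at this
  have hne := Finset.card_pos.2 (hplan T le_rfl hTpos).1.nonempty
  omega

end Planning

/-! ### Matchings as involutions and their augmentation -/

section Pairing

variable {V : Type} [Fintype V] [DecidableEq V]

/-- A matching of `G`, given as the involution that exchanges the ends of every matching edge. -/
def IsPairing (G : SimpleGraph V) (f : V → V) : Prop :=
  Function.Involutive f ∧ ∀ v, f v ≠ v → G.Adj v (f v)

/-- The vertices that a matching leaves uncovered. -/
def unpaired (f : V → V) : Finset V := Finset.univ.filter (fun v => f v = v)

theorem mem_unpaired {f : V → V} {v : V} : v ∈ unpaired f ↔ f v = v := by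
  simp [unpaired]

omit [Fintype V] [DecidableEq V] in
theorem IsPairing.mono {G G' : SimpleGraph V} (h : G ≤ G') {f : V → V} (hf : IsPairing G f) :
    IsPairing G' f :=
  ⟨hf.1, fun v hv => h (hf.2 v hv)⟩

theorem IsPairing.exists_join {G : SimpleGraph V} {f : V → V} (hf : IsPairing G f) {u v : V}
    (hu : f u = u) (hv : f v = v) (huv : G.Adj u v) :
    ∃ f', IsPairing G f' ∧ (unpaired f').card + 2 = (unpaired f).card := by
  have hne := huv.ne
  have hinv := hf.1
  refine ⟨fun a => if a = u then v else if a = v then u else f a, ⟨?_, ?_⟩, ?_⟩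
  · intro a
    have h1 := hinv a
    have h2 : f a = u → a = u := fun h => by rw [← h1, h, hu]
    have h3 : f a = v → a = v := fun h => by rw [← h1, h, hv]
    grind
  · intro a ha
    by_cases h1 : a = u
    · subst h1
      simpa using huv
    · by_cases h2 : a = v
      · subst h2
        simpa [h1] using huv.symm
      · simp only [h1, h2, if_false] at ha ⊢
        exact hf.2 a ha
  · have : unpaired (fun a => if a = u then v else if a = v then u else f a)
        = ((unpaired f).erase u).erase v := by
      ext a
      simp only [mem_unpaired, Finset.mem_erase]
      grind
    have hvm : v ∈ (unpaired f).erase u :=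
      Finset.mem_erase.2 ⟨hne.symm, mem_unpaired.2 hv⟩
    rw [this, ← Finset.card_erase_add_one (mem_unpaired.2 hu), ← Finset.card_erase_add_one hvm]

/-- Replacing the matching edge between `x` and `f x` by the edge between `u` and `x`. -/
theorem IsPairing.exists_rotate {G : SimpleGraph V} {f : V → V} (hf : IsPairing G f) {u x : V}
    (hu : f u = u) (hx : f x ≠ x) (hux : G.Adj u x) :
    ∃ f', IsPairing G f' ∧ (unpaired f').card = (unpaired f).card ∧ f' (f x) = f x ∧
      ∀ a, a ≠ u → a ≠ x → a ≠ f x → f' a = f a := by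
  have hne := hux.ne
  have hinv := hf.1
  have hxx := hinv x
  have hfxu : f x ≠ u := fun h => hne (by rw [← hxx, h, hu])
  refine ⟨fun a => if a = u then x else if a = x then u else if a = f x then f x else f a,
    ⟨?_, ?_⟩, ?_, ?_, ?_⟩
  · intro a
    have h1 := hinv a
    have h2 : f a = u → a = u := fun h => by rw [← h1, h, hu]
    have h3 : f a = x → a = f x := fun h => by rw [← h1, h]
    have h4 : f a = f x → a = x := fun h => hinv.injective h
    grind
  · intro a ha
    by_cases h1 : a = u
    · subst h1
      simpa using hux
    · by_cases h2 : a = x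
      · subst h2
        simpa [h1] using hux.symm
      · by_cases h3 : a = f x
        · simp [h3] at ha
          grind
        · simp only [h1, h2, h3, if_false] at ha ⊢
          exact hf.2 a ha
  · have : unpaired (fun a => if a = u then x else if a = x then u else
        if a = f x then f x else f a) = insert (f x) ((unpaired f).erase u) := by
      ext a
      simp only [mem_unpaired, Finset.mem_erase, Finset.mem_insert]
      grind
    rw [this, Finset.card_insert_of_notMem, Finset.card_erase_add_one (mem_unpaired.2 hu)]
    rw [Finset.mem_erase, mem_unpaired, hxx]
    exact fun h => hx h.2.symm
  · simp [hfxu, hx]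
  · intro a h1 h2 h3
    simp [h1, h2, h3]

/-- Augmentation along the path `u, x, f x, f w, w, v`. Two rotations move the uncovered vertices
from `u` and `v` to `f x` and `f w`, which the middle edge then joins. -/
theorem IsPairing.exists_augment {G : SimpleGraph V} {f : V → V} (hf : IsPairing G f)
    {u v x w : V} (hu : f u = u) (hv : f v = v) (huv : u ≠ v) (hx : f x ≠ x) (hw : f w ≠ w)
    (hwx : f w ≠ x) (hux : G.Adj u x) (hvw : G.Adj v w) (hxw : G.Adj (f x) (f w)) :
    ∃ f', IsPairing G f' ∧ (unpaired f').card + 2 = (unpaired f).card := by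
  have hinv := hf.1
  have hxx := hinv x
  have hww := hinv w
  have hne : w ≠ x := fun h => hxw.ne (by rw [h])
  have hwfx : w ≠ f x := fun h => hwx (by rw [h, hxx])
  have fne : ∀ a, f a ≠ a → a ≠ u ∧ a ≠ v := fun a ha =>
    ⟨fun h => ha (by rw [h, hu]), fun h => ha (by rw [h, hv])⟩
  have hfx : f (f x) ≠ f x := by rw [hxx]; exact hx.symm
  have hfw : f (f w) ≠ f w := by rw [hww]; exact hw.symm
  obtain ⟨f1, h1, c1, fix1, same1⟩ := hf.exists_rotate hu hx hux
  have e1w : f1 w = f w := same1 w (fne w hw).1 hne hwfx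
  have e1v : f1 v = v := by
    rw [same1 v huv.symm (fne x hx).2.symm (fne _ hfx).2.symm, hv]
  obtain ⟨f2, h2, c2, fix2, same2⟩ := h1.exists_rotate e1v (by rw [e1w]; exact hw) hvw
  rw [e1w] at fix2 same2
  have e2 : f2 (f x) = f x := by
    rw [same2 (f x) (fne _ hfx).2 hwfx.symm hxw.ne, fix1]
  obtain ⟨f3, h3, c3⟩ := h2.exists_join e2 fix2 hxw
  exact ⟨f3, h3, by rw [c3, c2, c1]⟩

theorem IsPairing.card_unpaired_parity {G : SimpleGraph V} {f : V → V} (hf : IsPairing G f) :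
    Fintype.card V ≡ (unpaired f).card [MOD 2] := by
  have h := Equiv.Perm.card_fixedPoints_modEq (f := f) (p := 2) (n := 1)
    (by funext a; exact hf.1 a)
  convert h using 1
  rw [← Set.toFinset_card]
  congr 1
  ext a
  simp [mem_unpaired, Function.mem_fixedPoints, Function.IsFixedPt]

/-! ### Deficiency and the level of a graph -/

/-- The least number of vertices that a matching of `G` leaves uncovered. -/
def deficiency (G : SimpleGraph V) : ℕ :=
  sInf {d | ∃ f, IsPairing G f ∧ (unpaired f).card = d}

theorem exists_pairing_card_eq_deficiency (G : SimpleGraph V) :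
    ∃ f, IsPairing G f ∧ (unpaired f).card = deficiency G :=
  Nat.sInf_mem (s := {d | ∃ f, IsPairing G f ∧ (unpaired f).card = d})
    ⟨_, id, ⟨fun _ => rfl, fun _ h => absurd rfl h⟩, rfl⟩

theorem IsPairing.deficiency_le {G : SimpleGraph V} {f : V → V} (hf : IsPairing G f) :
    deficiency G ≤ (unpaired f).card :=
  Nat.sInf_le ⟨f, hf, rfl⟩

open Classical in
/-- The number of further augmentations that a maximum matching of `G` needs in order to be perfect
or near-perfect, plus one if `G` has an isolated vertex. -/
def graphLevel (G : SimpleGraph V) : ℕ :=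
  deficiency G / 2 + if ∃ v, ∀ w, ¬ G.Adj v w then 1 else 0

theorem deficiency_antitone : Antitone (deficiency : SimpleGraph V → ℕ) := by
  intro G G' h
  obtain ⟨f, hf, hc⟩ := exists_pairing_card_eq_deficiency G
  rw [← hc]
  exact (hf.mono h).deficiency_le

theorem graphLevel_antitone : Antitone (graphLevel : SimpleGraph V → ℕ) := by
  classical
  intro G G' h
  unfold graphLevel
  have h1 := Nat.div_le_div_right (c := 2) (deficiency_antitone h)
  split_ifs with h2 h3
  · omega
  · obtain ⟨v, hv⟩ := h2
    exact absurd ⟨v, fun w hw => hv w (h hw)⟩ h3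
  · omega
  · omega

/-- The isolated-vertex summand cannot rise when edges are added, so the fall of the halved
deficiency is decisive. -/
theorem graphLevel_lt_of_deficiency {G G' : SimpleGraph V} (h : G ≤ G')
    (hd : deficiency G' + 2 ≤ deficiency G) : graphLevel G' < graphLevel G := by
  classical
  unfold graphLevel
  split_ifs with h2 h3
  · omega
  · obtain ⟨v, hv⟩ := h2
    exact absurd ⟨v, fun w hw => hv w (h hw)⟩ h3
  · omega
  · omega

theorem graphLevel_bot [Nonempty V] : graphLevel (⊥ : SimpleGraph V) = Fintype.card V / 2 + 1 := by
  classical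
  obtain ⟨f, hf, hc⟩ := exists_pairing_card_eq_deficiency (⊥ : SimpleGraph V)
  have : unpaired f = Finset.univ := by
    ext v
    simp only [mem_unpaired, Finset.mem_univ, iff_true]
    by_contra hv
    exact hf.2 v hv
  unfold graphLevel
  rw [if_pos ⟨Classical.arbitrary V, fun w hw => hw⟩, ← hc, this, Finset.card_univ]

theorem exists_adj_of_graphLevel_eq_zero {G : SimpleGraph V} (h : graphLevel G = 0) (v : V) :
    ∃ w, G.Adj v w := by
  classical
  unfold graphLevel at h
  split_ifs at h with h1
  push Not at h1
  exact h1 v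

theorem exists_perfectMatching_of_graphLevel_eq_zero {G : SimpleGraph V} (h : graphLevel G = 0)
    (hV : Even (Fintype.card V)) : ∃ M : G.Subgraph, M.IsPerfectMatching := by
  obtain ⟨f, hf, hc⟩ := exists_pairing_card_eq_deficiency G
  have hpar := hf.card_unpaired_parity
  have hlt : deficiency G / 2 = 0 := by
    unfold graphLevel at h
    omega
  -- Level zero only gives deficiency at most one; parity excludes one.
  have h0 : (unpaired f).card = 0 := by
    have h2 := Nat.even_iff.1 hV
    unfold Nat.ModEq at hpar
    omega
  have hne : ∀ v, f v ≠ v := fun v hv => by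
    rw [Finset.card_eq_zero] at h0
    have := mem_unpaired.2 hv
    rw [h0] at this
    simp at this
  refine ⟨{ verts := Set.univ, Adj := fun v w => f v = w, adj_sub := ?_, edge_vert := ?_,
            symm := ?_ }, ?_, ?_⟩
  · rintro v w rfl
    exact hf.2 v (hne v)
  · intro v w _
    trivial
  · refine ⟨?_⟩
    rintro v w rfl
    exact hf.1 v
  · intro v _
    exact ⟨f v, rfl, fun w hw => (show f v = w from hw).symm⟩
  · intro v
    trivial

/-! ### Lowering the level with edges of a well-connected graph -/

/-- In `H`, any two disjoint sets of `k` vertices are joined by an edge and every vertex has at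
least `3 k` neighbours. -/
structure WellConnected (H : SimpleGraph V) (k : ℕ) : Prop where
  pos : 0 < k
  joined : ∀ A B : Finset V, Disjoint A B → A.card = k → B.card = k →
    ∃ a ∈ A, ∃ b ∈ B, H.Adj a b
  degree : ∀ u, ∃ N : Finset V, 3 * k ≤ N.card ∧ ∀ v ∈ N, H.Adj u v

/-- A level above `k` means at least `2 * k` uncovered vertices, enough for two disjoint `k`-sets;
an edge of `H` between them extends the matching. -/
theorem WellConnected.exists_edge {H G : SimpleGraph V} {k : ℕ} (hH : WellConnected H k)
    (hG : k < graphLevel G) :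
    ∃ a b, H.Adj a b ∧ ∀ G', G ≤ G' → G'.Adj a b → graphLevel G' < graphLevel G := by
  classical
  obtain ⟨f, hf, hc⟩ := exists_pairing_card_eq_deficiency G
  have hd : 2 * k ≤ (unpaired f).card := by
    unfold graphLevel at hG
    split_ifs at hG <;> omega
  obtain ⟨A, hA, hAc⟩ := Finset.exists_subset_card_eq (s := unpaired f) (n := k) (by omega)
  obtain ⟨B, hB, hBc⟩ := Finset.exists_subset_card_eq (s := unpaired f \ A) (n := k) (by
    rw [Finset.card_sdiff_of_subset hA]; omega)
  obtain ⟨a, ha, b, hb, hab⟩ := hH.joined A B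
    (Finset.disjoint_left.2 fun x hx hx' => (Finset.mem_sdiff.1 (hB hx')).2 hx) hAc hBc
  refine ⟨a, b, hab, fun G' hGG' hadj => graphLevel_lt_of_deficiency hGG' ?_⟩
  obtain ⟨f', hf', hc'⟩ := (hf.mono hGG').exists_join (mem_unpaired.1 (hA ha))
    (mem_unpaired.1 (Finset.mem_sdiff.1 (hB hb)).1) hadj
  have := hf'.deficiency_le
  omega

/-- With two uncovered vertices `u` and `v`, either one has an uncovered neighbour in `H`, or the
partners of their neighbours form sets large enough to be joined in `H`, which gives an augmenting
path. With at most one uncovered vertex, an isolated vertex is all that is left to repair. -/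
theorem WellConnected.exists_three_edges {H G : SimpleGraph V} {k : ℕ} (hH : WellConnected H k)
    (hG : 0 < graphLevel G) :
    ∃ a₁ b₁ a₂ b₂ a₃ b₃, H.Adj a₁ b₁ ∧ H.Adj a₂ b₂ ∧ H.Adj a₃ b₃ ∧
      ∀ G', G ≤ G' → G'.Adj a₁ b₁ → G'.Adj a₂ b₂ → G'.Adj a₃ b₃ →
        graphLevel G' < graphLevel G := by
  classical
  obtain ⟨f, hf, hc⟩ := exists_pairing_card_eq_deficiency G
  have hkpos := hH.pos
  rcases Nat.lt_or_ge 1 (unpaired f).card with h2 | h2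
  · obtain ⟨u, hu, v, hv, huv⟩ := Finset.one_lt_card.1 h2
    have hjoin : ∀ a, a ∈ unpaired f → ∀ x, H.Adj a x → f x = x →
        ∃ a₁ b₁ a₂ b₂ a₃ b₃, H.Adj a₁ b₁ ∧ H.Adj a₂ b₂ ∧ H.Adj a₃ b₃ ∧
          ∀ G', G ≤ G' → G'.Adj a₁ b₁ → G'.Adj a₂ b₂ → G'.Adj a₃ b₃ →
            graphLevel G' < graphLevel G := by
      intro a ha x hax hx
      -- One edge suffices; it is repeated to fill the three places.
      refine ⟨a, x, a, x, a, x, hax, hax, hax, fun G' hGG' hadj _ _ =>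
        graphLevel_lt_of_deficiency hGG' ?_⟩
      obtain ⟨f', hf', hc'⟩ := (hf.mono hGG').exists_join (mem_unpaired.1 ha) hx hadj
      have := hf'.deficiency_le
      omega
    obtain ⟨N, hNc, hN⟩ := hH.degree u
    obtain ⟨N', hNc', hN'⟩ := hH.degree v
    by_cases hNu : ∃ x ∈ N, f x = x
    · obtain ⟨x, hx, hfx⟩ := hNu
      exact hjoin u hu x (hN x hx) hfx
    by_cases hNv : ∃ x ∈ N', f x = x
    · obtain ⟨x, hx, hfx⟩ := hNv
      exact hjoin v hv x (hN' x hx) hfx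
    push Not at hNu hNv
    obtain ⟨Y, hY, hYc⟩ := Finset.exists_subset_card_eq (s := N.image f) (n := k) (by
      rw [Finset.card_image_of_injective _ hf.1.injective]; omega)
    -- Removing `Y` makes the two sets disjoint; removing `Y.image f` makes the two matching edges
    -- on the path distinct. This costs at most `2 * k` vertices, whence the degree `3 * k`.
    obtain ⟨Z, hZ, hZc⟩ := Finset.exists_subset_card_eq
      (s := N'.image f \ (Y ∪ Y.image f)) (n := k) (by
      have e1 := Finset.le_card_sdiff (Y ∪ Y.image f) (N'.image f)
      have e2 := Finset.card_union_le Y (Y.image f)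
      rw [Finset.card_image_of_injective _ hf.1.injective] at e1 e2
      omega)
    obtain ⟨y, hy, z, hz, hyz⟩ := hH.joined Y Z
      (Finset.disjoint_left.2 fun x hx hx' =>
        (Finset.mem_sdiff.1 (hZ hx')).2 (Finset.mem_union_left _ hx)) hYc hZc
    obtain ⟨x, hx, rfl⟩ := Finset.mem_image.1 (hY hy)
    have hz' := Finset.mem_sdiff.1 (hZ hz)
    obtain ⟨w, hw, rfl⟩ := Finset.mem_image.1 hz'.1
    have hwx : f w ≠ x := fun h => hz'.2 (Finset.mem_union_right _
      (Finset.mem_image.2 ⟨f x, hy, by rw [h]; exact hf.1 x⟩))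
    refine ⟨u, x, v, w, f x, f w, hN x hx, hN' w hw, hyz, fun G' hGG' a1 a2 a3 =>
      graphLevel_lt_of_deficiency hGG' ?_⟩
    obtain ⟨f', hf', hc'⟩ := (hf.mono hGG').exists_augment (mem_unpaired.1 hu)
      (mem_unpaired.1 hv) huv (hNu x hx) (hNv w hw) hwx a1 a2 a3
    have := hf'.deficiency_le
    omega
  · have hd0 : deficiency G / 2 = 0 := by omega
    have hiso : ∃ v, ∀ w, ¬ G.Adj v w := by
      unfold graphLevel at hG
      split_ifs at hG with h
      · exact h
      · omega
    obtain ⟨v, hv⟩ := hiso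
    obtain ⟨N, hNc, hN⟩ := hH.degree v
    obtain ⟨x, hx⟩ : N.Nonempty := Finset.card_pos.1 (by omega)
    refine ⟨v, x, v, x, v, x, hN x hx, hN x hx, hN x hx, fun G' hGG' hadj _ _ => ?_⟩
    have hd' := deficiency_antitone hGG'
    -- The isolated vertex `v` is the only uncovered one, so every other vertex has its partner as a
    -- neighbour.
    have hcov : ¬ ∃ a, ∀ w, ¬ G'.Adj a w := by
      rintro ⟨a, ha⟩
      have hfv : f v = v := by
        by_contra h
        exact hv _ (hf.2 v h)
      have hfa : f a ≠ a := by
        intro h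
        have := Finset.card_le_one.1 h2 a (mem_unpaired.2 h) v (mem_unpaired.2 hfv)
        subst this
        exact ha x hadj
      exact ha _ (hGG' (hf.2 a hfa))
    unfold graphLevel
    rw [if_neg hcov, if_pos ⟨v, hv⟩]
    omega

end Pairing

/-! ### The level of a set of edges of the complete graph -/

section Complete

variable {n : ℕ}

/-- The edge of the complete graph between two distinct vertices. -/
def kEdge {u v : Fin n} (h : u ≠ v) : KEdge n := ⟨s(u, v), by simpa using h⟩

theorem graphOf_adj {A : Set (KEdge n)} {u v : Fin n} :
    (graphOf A).Adj u v ↔ ∃ h : u ≠ v, kEdge h ∈ A := by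
  unfold graphOf
  rw [SimpleGraph.fromEdgeSet_adj]
  constructor
  · rintro ⟨⟨e, he, hev⟩, hne⟩
    refine ⟨hne, ?_⟩
    rwa [show kEdge hne = e from Subtype.ext hev.symm]
  · rintro ⟨h, hA⟩
    exact ⟨⟨_, hA, rfl⟩, h⟩

theorem graphOf_mono {A B : Set (KEdge n)} (h : A ⊆ B) : graphOf A ≤ graphOf B := by
  intro u v huv
  rw [graphOf_adj] at huv ⊢
  obtain ⟨hne, hA⟩ := huv
  exact ⟨hne, h hA⟩

/-- The level of Maker's graph. -/
def edgeLevel (n : ℕ) (A : Set (KEdge n)) : ℕ := graphLevel (graphOf A)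

theorem edgeLevel_antitone : Antitone (edgeLevel n) :=
  fun _ _ h => graphLevel_antitone (graphOf_mono h)

theorem edgeLevel_empty (hn : 0 < n) : edgeLevel n ∅ = n / 2 + 1 := by
  have hbot : graphOf (∅ : Set (KEdge n)) = ⊥ := by simp [graphOf]
  have : Nonempty (Fin n) := ⟨⟨0, hn⟩⟩
  unfold edgeLevel
  rw [hbot, graphLevel_bot, Fintype.card_fin]

theorem mem_minDegreeOneGame_iff {A : Set (KEdge n)} :
    A ∈ minDegreeOneGame n ↔ ∀ v, ∃ w, (graphOf A).Adj v w := by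
  classical
  unfold minDegreeOneGame
  rw [Set.mem_ofPred_eq]
  refine forall_congr' fun v => ?_
  rw [Nat.one_le_iff_ne_zero, ← Nat.pos_iff_ne_zero, SimpleGraph.degree_pos_iff_exists_adj]

theorem mem_minDegreeOneGame_of_edgeLevel {A : Set (KEdge n)} (h : edgeLevel n A = 0) :
    A ∈ minDegreeOneGame n :=
  mem_minDegreeOneGame_iff.2 (exists_adj_of_graphLevel_eq_zero h)

theorem mem_perfectMatchingGame_of_edgeLevel {A : Set (KEdge n)} (h : edgeLevel n A = 0)
    (hn : Even n) : A ∈ perfectMatchingGame n :=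
  exists_perfectMatching_of_graphLevel_eq_zero h (by simpa using hn)

theorem perfectMatchingGame_subset : perfectMatchingGame n ⊆ minDegreeOneGame n := by
  rintro A ⟨M, hM⟩
  rw [mem_minDegreeOneGame_iff]
  intro v
  obtain ⟨w, hw, -⟩ := hM.1 (hM.2 v)
  exact ⟨w, hw.adj_sub⟩

theorem WellConnected.exists_kEdge {X : Set (KEdge n)} {k : ℕ}
    (hX : WellConnected (graphOf Xᶜ) k) (A : Set (KEdge n)) (hA : k < edgeLevel n A) :
    ∃ e, e ∉ X ∧ edgeLevel n (insert e A) < edgeLevel n A := by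
  obtain ⟨a, b, hab, h⟩ := hX.exists_edge hA
  obtain ⟨hne, he⟩ := graphOf_adj.1 hab
  exact ⟨kEdge hne, he, h _ (graphOf_mono (Set.subset_insert _ _))
    (graphOf_adj.2 ⟨hne, Set.mem_insert _ _⟩)⟩

theorem WellConnected.exists_three_kEdges {X : Set (KEdge n)} {k : ℕ}
    (hX : WellConnected (graphOf Xᶜ) k) (A : Set (KEdge n)) (hA : 0 < edgeLevel n A) :
    ∃ P : Finset (KEdge n), P.card ≤ 3 ∧ (∀ e ∈ P, e ∉ X) ∧
      edgeLevel n (A ∪ P) < edgeLevel n A := by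
  classical
  obtain ⟨a₁, b₁, a₂, b₂, a₃, b₃, h₁, h₂, h₃, h⟩ := hX.exists_three_edges hA
  obtain ⟨n₁, e₁⟩ := graphOf_adj.1 h₁
  obtain ⟨n₂, e₂⟩ := graphOf_adj.1 h₂
  obtain ⟨n₃, e₃⟩ := graphOf_adj.1 h₃
  refine ⟨{kEdge n₁, kEdge n₂, kEdge n₃}, Finset.card_le_three, ?_, ?_⟩
  · intro e he
    simp only [Finset.mem_insert, Finset.mem_singleton] at he
    rcases he with rfl | rfl | rfl
    · exact e₁
    · exact e₂
    · exact e₃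
  · exact h _ (graphOf_mono Set.subset_union_left) (graphOf_adj.2 ⟨n₁, by simp⟩)
      (graphOf_adj.2 ⟨n₂, by simp⟩) (graphOf_adj.2 ⟨n₃, by simp⟩)

end Complete

/-! ### The probability that Maker's strategy fails -/

section Failure

variable {n : ℕ}

open Classical in
/-- The edges of the complete graph between `A` and `B`. -/
def joinEdges (A B : Finset (Fin n)) : Finset (KEdge n) :=
  Finset.univ.filter (fun e => ∃ a ∈ A, ∃ b ∈ B, ∃ h : a ≠ b, e = kEdge h)

theorem mem_joinEdges {A B : Finset (Fin n)} {e : KEdge n} :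
    e ∈ joinEdges A B ↔ ∃ a ∈ A, ∃ b ∈ B, ∃ h : a ≠ b, e = kEdge h := by
  simp [joinEdges]

theorem card_mul_card_le_card_joinEdges {A B : Finset (Fin n)} (hAB : Disjoint A B) :
    A.card * B.card ≤ (joinEdges A B).card := by
  classical
  rw [← Finset.card_product]
  have hinj : Set.InjOn (fun p : Fin n × Fin n => s(p.1, p.2)) (A ×ˢ B : Finset _) := by
    rintro ⟨a, b⟩ hp ⟨a', b'⟩ hp' h
    simp only [Finset.coe_product, Set.mem_prod, Finset.mem_coe] at hp hp'
    rcases Sym2.eq_iff.1 h with ⟨h1, h2⟩ | ⟨h1, -⟩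
    · exact Prod.ext h1 h2
    · exact absurd ((show a = b' from h1) ▸ hp.1 : b' ∈ A) (fun h' => Finset.disjoint_left.1 hAB h' hp'.2)
  rw [← Finset.card_image_of_injOn hinj]
  refine le_trans (Finset.card_le_card ?_)
    (Finset.card_image_le (s := joinEdges A B) (f := Subtype.val))
  intro x hx
  obtain ⟨⟨a, b⟩, hp, rfl⟩ := Finset.mem_image.1 hx
  rw [Finset.mem_product] at hp
  have hne : a ≠ b := fun h => Finset.disjoint_left.1 hAB hp.1 (h ▸ hp.2)
  exact Finset.mem_image.2 ⟨kEdge hne, mem_joinEdges.2 ⟨a, hp.1, b, hp.2, hne, rfl⟩, rfl⟩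

theorem card_kEdge (n : ℕ) : Fintype.card (KEdge n) = n.choose 2 := by
  have h := SimpleGraph.card_edgeFinset_top_eq_card_choose_two (V := Fin n)
  rw [Fintype.card_fin] at h
  rw [← h, ← SimpleGraph.edgeFinset_card]

theorem missing_nil {E : Type} (b : ℕ) (W : Finset E) : missing b W [] = W.card := by
  classical
  unfold missing
  congr 1
  rw [Finset.filter_eq_self]
  rintro e - ⟨j, -, hj⟩
  simp at hj

theorem wellConnected_of_not_subset {X : Set (KEdge n)} {k : ℕ} (hk : 0 < k) (hkn : 3 * k ≤ n)
    (h1 : ∀ A B : Finset (Fin n), Disjoint A B → A.card = k → B.card = k →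
      ¬ ∀ e ∈ joinEdges A B, e ∈ X)
    (h2 : ∀ (u : Fin n) (D : Finset (Fin n)), D.card = 3 * k →
      ¬ ∀ e ∈ joinEdges {u} ((Finset.univ.erase u) \ D), e ∈ X) :
    WellConnected (graphOf Xᶜ) k := by
  classical
  refine ⟨hk, fun A B hAB hA hB => ?_, fun u => ?_⟩
  · have h := h1 A B hAB hA hB
    push Not at h
    obtain ⟨e, he, heX⟩ := h
    obtain ⟨a, ha, b, hb, hne, rfl⟩ := mem_joinEdges.1 he
    exact ⟨a, ha, b, hb, graphOf_adj.2 ⟨hne, heX⟩⟩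
  · refine ⟨Finset.univ.filter (fun v => (graphOf Xᶜ).Adj u v), ?_, fun v hv =>
      (Finset.mem_filter.1 hv).2⟩
    by_contra hlt
    -- Too small a neighbourhood is padded to exactly `3 * k` vertices, so that the bad stars can be
    -- counted by sets `D` of one size.
    obtain ⟨D, hD, hDc⟩ := Finset.exists_superset_card_eq
      (s := Finset.univ.filter (fun v => (graphOf Xᶜ).Adj u v)) (n := 3 * k) (by omega)
      (by simpa using hkn)
    have h := h2 u D hDc
    push Not at h
    obtain ⟨e, he, heX⟩ := h
    obtain ⟨a, ha, b, hb, hne, rfl⟩ := mem_joinEdges.1 he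
    rw [Finset.mem_singleton] at ha
    subst ha
    exact (Finset.mem_sdiff.1 hb).2 (hD (Finset.mem_filter.2
      ⟨Finset.mem_univ _, graphOf_adj.2 ⟨hne, heX⟩⟩))

theorem hitRatio_zero_right (N m : ℕ) : hitRatio N m 0 = m / N := by
  simp [hitRatio]

theorem prob_exists_join_subset_le {b : ℕ} {S : Strategy (KEdge n)} {m : ℕ} {r : ℝ} (hr0 : 0 ≤ r)
    (hr1 : r ≤ 1) (hm : m ≤ Fintype.card (KEdge n)) (hmr : (m : ℝ) / Fintype.card (KEdge n) ≤ r)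
    (I : Finset (Finset (Fin n) × Finset (Fin n))) (w : ℕ)
    (hI : ∀ p ∈ I, Disjoint p.1 p.2 ∧ w ≤ p.1.card * p.2.card) :
    (play b S).toOuterMeasure
        {γ | ∃ p ∈ I, ∀ e ∈ joinEdges p.1 p.2, e ∈ breakerSet b (γ.take m)}
      ≤ ENNReal.ofReal (I.card * r ^ w) := by
  refine prob_exists_subset_breakerSet_le (fun _ => I) (fun p => joinEdges p.1 p.2)
    (Nat.zero_le m) hm fun h hh => ?_
  rw [List.length_eq_zero_iff] at hh
  subst hh
  rw [hitRatio_zero_right, ← nsmul_eq_mul]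
  refine Finset.sum_le_card_nsmul _ _ _ fun p hp => ?_
  rw [missing_nil]
  have h0 : (0 : ℝ) ≤ (m : ℝ) / Fintype.card (KEdge n) := by positivity
  calc ((m : ℝ) / Fintype.card (KEdge n)) ^ (joinEdges p.1 p.2).card
      ≤ r ^ (joinEdges p.1 p.2).card := pow_le_pow_left₀ h0 hmr _
    _ ≤ r ^ w := pow_le_pow_of_le_one hr0 hr1
        ((hI p hp).2.trans (card_mul_card_le_card_joinEdges (hI p hp).1))

/-- Given the play up to a round, each of at most three pending elements is hit in that round with
probability at most `b + 1` over the number of free elements. -/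
theorem prob_pending_hit_le {E : Type} [Fintype E] {b : ℕ} {L : Set E → ℕ} {S : Strategy E}
    {i T : ℕ} (hi : i < T) (hT : T * (b + 1) < Fintype.card E) :
    (play b S).toOuterMeasure {γ | ∃ e ∈ pending b L (γ.take (i * (b + 1))),
        e ∈ breakerSet b (γ.take ((i + 1) * (b + 1)))}
      ≤ ENNReal.ofReal (3 * (((b : ℝ) + 1) / (Fintype.card E - (T * (b + 1) : ℕ)))) := by
  classical
  have h1 : (i + 1) * (b + 1) ≤ T * (b + 1) := Nat.mul_le_mul_right _ hi
  have h2 : i * (b + 1) ≤ (i + 1) * (b + 1) := Nat.mul_le_mul_right _ (Nat.le_succ i)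
  have hpos : (0 : ℝ) < Fintype.card E - (T * (b + 1) : ℕ) := by
    rw [sub_pos]
    exact_mod_cast hT
  refine le_trans (MeasureTheory.measure_mono ?_)
    (prob_exists_subset_breakerSet_le (pending b L) (fun e => ({e} : Finset E)) h2
      (h1.trans hT.le) fun h hh => ?_)
  · rintro γ ⟨e, he, heb⟩
    exact ⟨e, he, fun x hx => by rw [Finset.mem_singleton] at hx; rwa [hx]⟩
  · have hq : hitRatio (Fintype.card E) ((i + 1) * (b + 1)) (i * (b + 1))
        ≤ ((b : ℝ) + 1) / (Fintype.card E - (T * (b + 1) : ℕ)) := by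
      unfold hitRatio
      have e1 : (((i + 1) * (b + 1) : ℕ) : ℝ) - (i * (b + 1) : ℕ) = b + 1 := by
        push_cast; ring
      rw [e1]
      have e2 : ((i * (b + 1) : ℕ) : ℝ) ≤ (T * (b + 1) : ℕ) := by
        exact_mod_cast h2.trans h1
      refine div_le_div_of_nonneg_left (by positivity) hpos (by linarith)
    have hmiss : ∀ e ∈ pending b L h, missing b {e} h = 1 := by
      intro e he
      unfold missing
      rw [Finset.filter_true_of_mem, Finset.card_singleton]
      intro x hx hxb
      rw [Finset.mem_singleton] at hx
      subst hx
      exact pending_free he (breakerSet_subset b h hxb)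
    have hb0 : (0 : ℝ) ≤ ((b : ℝ) + 1) / (Fintype.card E - (T * (b + 1) : ℕ)) := by positivity
    calc ∑ e ∈ pending b L h, hitRatio (Fintype.card E) ((i + 1) * (b + 1)) (i * (b + 1))
            ^ missing b {e} h
        ≤ ∑ e ∈ pending b L h, ((b : ℝ) + 1) / (Fintype.card E - (T * (b + 1) : ℕ)) := by
          refine Finset.sum_le_sum fun e he => ?_
          rw [hmiss e he, pow_one]
          exact hq
      _ = (pending b L h).card * (((b : ℝ) + 1) / (Fintype.card E - (T * (b + 1) : ℕ))) := by
          rw [Finset.sum_const, nsmul_eq_mul]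
      _ ≤ 3 * (((b : ℝ) + 1) / (Fintype.card E - (T * (b + 1) : ℕ))) := by
          refine mul_le_mul_of_nonneg_right ?_ hb0
          exact_mod_cast card_pending_le b L h

/-- The three summands bound, in order, the chance of a fully occupied join of two `k`-sets, of a
fully occupied large star, and of a hit on a pending edge in one of the last `3 * k` rounds. -/
theorem prob_edgeLevel_ne_zero_le {b k : ℕ} {δ : ℝ} (hδ0 : 0 < δ) (hδ1 : δ < 1)
    (hk : 0 < k) (hkn : 3 * k < n)
    (hm : (((n / 2 + 1 + 2 * k) * (b + 1) : ℕ) : ℝ) ≤ (1 - δ) * (n.choose 2 : ℕ)) :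
    (play b (planStrategy b (edgeLevel n))).toOuterMeasure
        {γ | edgeLevel n (makerAfter b (n / 2 + 1 + 2 * k) γ) ≠ 0}
      ≤ ENNReal.ofReal ((n : ℝ) ^ (2 * k) * (1 - δ) ^ (k * k)
          + (n : ℝ) ^ (3 * k + 1) * (1 - δ) ^ (n - 1 - 3 * k)
          + 3 * k * (3 * (((b : ℝ) + 1) / (δ * (n.choose 2 : ℕ))))) := by
  classical
  have hcard := card_kEdge n
  set T := n / 2 + 1 + 2 * k with hT
  set m := T * (b + 1) with hmdef
  set N := n.choose 2 with hN
  have hNpos : 0 < N := Nat.choose_pos (by omega)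
  have hNpos' : (0 : ℝ) < N := by exact_mod_cast hNpos
  have hmN : m < N := by
    have : (m : ℝ) < N := by nlinarith
    exact_mod_cast this
  have hratio : (m : ℝ) / Fintype.card (KEdge n) ≤ 1 - δ := by
    rw [hcard, div_le_iff₀ hNpos']
    exact hm
  set S := planStrategy b (edgeLevel n) with hS
  set I₁ : Finset (Finset (Fin n) × Finset (Fin n)) :=
    ((Finset.powersetCard k Finset.univ) ×ˢ (Finset.powersetCard k Finset.univ)).filter
      (fun p => Disjoint p.1 p.2) with hI₁
  set I₂ : Finset (Finset (Fin n) × Finset (Fin n)) :=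
    ((Finset.univ : Finset (Fin n)) ×ˢ (Finset.powersetCard (3 * k) Finset.univ)).image
      (fun p => ({p.1}, (Finset.univ.erase p.1) \ p.2)) with hI₂
  have hc₁ : (I₁.card : ℝ) ≤ (n : ℝ) ^ (2 * k) := by
    have : I₁.card ≤ n ^ (2 * k) := by
      refine (Finset.card_filter_le _ _).trans ?_
      rw [Finset.card_product, Finset.card_powersetCard, Finset.card_univ, Fintype.card_fin,
        two_mul, pow_add]
      exact Nat.mul_le_mul (Nat.choose_le_pow n k) (Nat.choose_le_pow n k)
    exact_mod_cast this
  have hc₂ : (I₂.card : ℝ) ≤ (n : ℝ) ^ (3 * k + 1) := by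
    have : I₂.card ≤ n ^ (3 * k + 1) := by
      refine Finset.card_image_le.trans ?_
      rw [Finset.card_product, Finset.card_powersetCard, Finset.card_univ, Fintype.card_fin,
        pow_succ, mul_comm]
      exact Nat.mul_le_mul_right _ (Nat.choose_le_pow n _)
    exact_mod_cast this
  have hp₁ := prob_exists_join_subset_le (b := b) (S := S) (by linarith : (0 : ℝ) ≤ 1 - δ)
    (by linarith) (by rw [hcard]; exact hmN.le) hratio I₁ (k * k) (by
      intro p hp
      rw [hI₁, Finset.mem_filter, Finset.mem_product, Finset.mem_powersetCard,
        Finset.mem_powersetCard] at hp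
      exact ⟨hp.2, by rw [hp.1.1.2, hp.1.2.2]⟩)
  have hp₂ := prob_exists_join_subset_le (b := b) (S := S) (by linarith : (0 : ℝ) ≤ 1 - δ)
    (by linarith) (by rw [hcard]; exact hmN.le) hratio I₂ (n - 1 - 3 * k) (by
      intro p hp
      obtain ⟨⟨u, D⟩, hq, rfl⟩ := Finset.mem_image.1 hp
      rw [Finset.mem_product, Finset.mem_powersetCard] at hq
      refine ⟨?_, ?_⟩
      · simp
      · have := Finset.le_card_sdiff D (Finset.univ.erase u)
        rw [Finset.card_erase_of_mem (Finset.mem_univ u), Finset.card_univ, Fintype.card_fin,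
          hq.2.2] at this
        simpa using this)
  set B₃ : ℕ → Set (List (KEdge n)) := fun i =>
    {γ | ∃ e ∈ pending b (edgeLevel n) (γ.take (i * (b + 1))),
      e ∈ breakerSet b (γ.take ((i + 1) * (b + 1)))} with hB₃
  have hp₃ : (play b S).toOuterMeasure (⋃ i ∈ Finset.Ico (n / 2 + 1 - k) T, B₃ i)
      ≤ ENNReal.ofReal (3 * k * (3 * (((b : ℝ) + 1) / (δ * (n.choose 2 : ℕ))))) := by
    refine (MeasureTheory.measure_biUnion_finset_le _ _).trans ?_
    have hle : ∀ i ∈ Finset.Ico (n / 2 + 1 - k) T, (play b S).toOuterMeasure (B₃ i)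
        ≤ ENNReal.ofReal (3 * (((b : ℝ) + 1) / (δ * (n.choose 2 : ℕ)))) := by
      intro i hi
      refine (prob_pending_hit_le (Finset.mem_Ico.1 hi).2 (by rw [hcard]; exact hmN)).trans ?_
      refine ENNReal.ofReal_le_ofReal ?_
      have h1 : δ * (N : ℝ) ≤ (N : ℝ) - (m : ℕ) := by linarith
      have h2 : 0 < δ * (N : ℝ) := by positivity
      rw [hcard]
      have := div_le_div_of_nonneg_left (by positivity : (0 : ℝ) ≤ (b : ℝ) + 1) h2 h1
      linarith
    refine (Finset.sum_le_card_nsmul _ _ _ hle).trans ?_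
    rw [nsmul_eq_mul, Nat.card_Ico, ← ENNReal.ofReal_natCast,
      ← ENNReal.ofReal_mul (Nat.cast_nonneg _)]
    refine ENNReal.ofReal_le_ofReal ?_
    have : T - (n / 2 + 1 - k) ≤ 3 * k := by omega
    have : ((T - (n / 2 + 1 - k) : ℕ) : ℝ) ≤ 3 * k := by exact_mod_cast this
    gcongr
  have hsub : ∀ γ ∈ (play b S).support,
      γ ∈ {γ | edgeLevel n (makerAfter b T γ) ≠ 0} →
      γ ∈ ({γ | ∃ p ∈ I₁, ∀ e ∈ joinEdges p.1 p.2, e ∈ breakerSet b (γ.take m)} ∪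
        {γ | ∃ p ∈ I₂, ∀ e ∈ joinEdges p.1 p.2, e ∈ breakerSet b (γ.take m)}) ∪
        ⋃ i ∈ Finset.Ico (n / 2 + 1 - k) T, B₃ i := by
    intro γ hγ hne
    by_contra hnot
    simp only [Set.mem_union, not_or] at hnot
    obtain ⟨⟨hn₁, hn₂⟩, hn₃⟩ := hnot
    apply hne
    obtain ⟨hl, hlen⟩ := legal_of_mem_support hγ
    have hW : WellConnected (graphOf (breakerSet b (γ.take m))ᶜ) k := by
      refine wellConnected_of_not_subset hk hkn.le ?_ ?_
      · intro A B hAB hA hB hall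
        exact hn₁ ⟨(A, B), by simp [hI₁, hAB, hA, hB], hall⟩
      · intro u D hD hall
        refine hn₂ ⟨({u}, (Finset.univ.erase u) \ D), ?_, hall⟩
        exact Finset.mem_image.2 ⟨(u, D), by simp [hD], rfl⟩
    have hL0 : edgeLevel n ∅ = n / 2 + 1 := edgeLevel_empty (by omega)
    refine level_eq_zero edgeLevel_antitone (s := k) (by omega) (by omega) hl ?_ ?_ ?_ ?_
    · rw [hlen, min_self, hcard]
      exact hmN.le
    · exact fun A hA => hW.exists_kEdge A hA
    · exact fun A hA => hW.exists_three_kEdges A hA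
    · intro i hi hiT e he heb
      rw [hL0] at hi
      exact hn₃ (Set.mem_biUnion (Finset.mem_coe.2 (Finset.mem_Ico.2 ⟨hi, hiT⟩)) ⟨e, he, heb⟩)
  have hδ' : (0 : ℝ) ≤ 1 - δ := by linarith
  calc (play b S).toOuterMeasure {γ | edgeLevel n (makerAfter b T γ) ≠ 0}
      ≤ _ := toOuterMeasure_le_of_support _ hsub
    _ ≤ _ := (MeasureTheory.measure_union_le _ _).trans
        (add_le_add (MeasureTheory.measure_union_le _ _) le_rfl)
    _ ≤ _ := add_le_add (add_le_add hp₁ hp₂) hp₃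
    _ = ENNReal.ofReal (I₁.card * (1 - δ) ^ (k * k) + I₂.card * (1 - δ) ^ (n - 1 - 3 * k)
          + 3 * k * (3 * (((b : ℝ) + 1) / (δ * (n.choose 2 : ℕ))))) := by
        rw [← ENNReal.ofReal_add (by positivity) (by positivity),
          ← ENNReal.ofReal_add (by positivity) (by positivity)]
    _ ≤ _ := by
        refine ENNReal.ofReal_le_ofReal ?_
        gcongr

end Failure

/-! ### Asymptotics -/

section Asymptotics

/-- The number of vertices that Maker's greedy matching may leave uncovered, up to a factor. -/
def slack (δ : ℝ) (n : ℕ) : ℕ := ⌈3 / δ * Real.log n⌉₊ + 1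

theorem slack_le {δ : ℝ} (hδ : 0 < δ) (n : ℕ) :
    (slack δ n : ℝ) ≤ 3 / δ * Real.log n + 2 := by
  unfold slack
  have h0 : 0 ≤ 3 / δ * Real.log n :=
    mul_nonneg (by positivity) (Real.log_natCast_nonneg n)
  have := Nat.ceil_lt_add_one h0
  push_cast
  linarith

theorem le_slack {δ : ℝ} (hδ : 0 < δ) (n : ℕ) : 3 * Real.log n ≤ δ * slack δ n := by
  have h1 : 3 / δ * Real.log n ≤ (slack δ n : ℝ) := by
    unfold slack
    push_cast
    have := Nat.le_ceil (3 / δ * Real.log n)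
    linarith
  calc 3 * Real.log n = δ * (3 / δ * Real.log n) := by field_simp
    _ ≤ δ * slack δ n := by gcongr

theorem tendsto_log_natCast_atTop : Tendsto (fun n : ℕ => Real.log n) atTop atTop :=
  Real.tendsto_log_atTop.comp tendsto_natCast_atTop_atTop

theorem eventually_slack_mul_log_le {δ η : ℝ} (hδ : 0 < δ) (hη : 0 < η) :
    ∀ᶠ n : ℕ in atTop, (slack δ n : ℝ) * Real.log n ≤ η * n := by
  have hc : 0 < η / (3 / δ + 2) := by positivity
  have h2 : ∀ᶠ n : ℕ in atTop, ‖Real.log (n : ℝ) ^ 2‖ ≤ η / (3 / δ + 2) * ‖id (n : ℝ)‖ :=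
    tendsto_natCast_atTop_atTop.eventually
      ((Real.isLittleO_pow_log_id_atTop (n := 2)).bound hc)
  filter_upwards [h2, tendsto_log_natCast_atTop.eventually_ge_atTop 1] with n h2 h1
  have hs := slack_le hδ n
  rw [Real.norm_of_nonneg (by positivity), id, Real.norm_of_nonneg (by positivity)] at h2
  have h3 : (slack δ n : ℝ) ≤ (3 / δ + 2) * Real.log n := by nlinarith
  calc (slack δ n : ℝ) * Real.log n ≤ (3 / δ + 2) * Real.log n * Real.log n := by gcongr
    _ = (3 / δ + 2) * Real.log n ^ 2 := by ring
    _ ≤ (3 / δ + 2) * (η / (3 / δ + 2) * n) := by gcongr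
    _ = η * n := by field_simp

theorem eventually_slack_le {δ η : ℝ} (hδ : 0 < δ) (hη : 0 < η) :
    ∀ᶠ n : ℕ in atTop, (slack δ n : ℝ) ≤ η * n := by
  filter_upwards [eventually_slack_mul_log_le hδ hη,
    tendsto_log_natCast_atTop.eventually_ge_atTop 1] with n h h1
  refine le_trans ?_ h
  exact le_mul_of_one_le_right (Nat.cast_nonneg _) h1

theorem eventually_moves_le {ε : ℝ} (hε0 : 0 < ε) (hε1 : ε < 1) :
    ∀ᶠ n : ℕ in atTop, ∀ b : ℕ, (b : ℝ) ≤ (1 - ε) * n →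
      (((n / 2 + 1 + 2 * slack (ε / 2) n) * (b + 1) : ℕ) : ℝ)
        ≤ (1 - ε / 2) * (n.choose 2 : ℕ) := by
  have hη : 0 < ε / 60 := by positivity
  filter_upwards [eventually_slack_le (half_pos hε0) hη,
    tendsto_natCast_atTop_atTop.eventually_ge_atTop (60 / ε)] with n hs hn b hb
  have hn' : 1 ≤ ε / 60 * n := by
    calc (1 : ℝ) = ε / 60 * (60 / ε) := by field_simp
      _ ≤ ε / 60 * n := by gcongr
  rw [Nat.cast_choose_two]
  have hdiv : ((n / 2 : ℕ) : ℝ) ≤ n / 2 := Nat.cast_div_le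
  set η := ε / 60 with hηdef
  have hεη : ε = 60 * η := by rw [hηdef]; ring
  set x : ℝ := (n : ℝ) with hx
  have hx0 : 0 ≤ x := Nat.cast_nonneg n
  push_cast
  have h1 : ((n / 2 : ℕ) : ℝ) + 1 + 2 * slack (ε / 2) n ≤ (1 / 2 + 3 * η) * x := by
    linarith
  have h2 : (b : ℝ) + 1 ≤ (1 - ε + η) * x := by linarith
  calc _ ≤ ((1 / 2 + 3 * η) * x) * ((1 - ε + η) * x) := by gcongr
    _ ≤ (1 - ε / 2) * ((1 - η) * x * x / 2) := by
        have hx2 : 0 ≤ x * x := mul_nonneg hx0 hx0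
        -- With `ε = 60 * η`, the coefficients of `η` are `-26.5` on the left and `-15.5` on the
        -- right, which leaves room for the quadratic terms.
        have hcoef : (1 / 2 + 3 * η) * (1 - ε + η) ≤ (1 - ε / 2) * (1 - η) / 2 := by
          rw [hεη] at hε1 ⊢
          nlinarith
        nlinarith
    _ ≤ (1 - ε / 2) * (x * (x - 1) / 2) := by
        have : 0 ≤ 1 - ε / 2 := by linarith
        refine mul_le_mul_of_nonneg_left ?_ this
        nlinarith

theorem one_sub_pow_le_exp {δ : ℝ} (hδ : δ ≤ 1) (w : ℕ) :
    (1 - δ) ^ w ≤ Real.exp (-(δ * w)) := by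
  have h := Real.one_sub_le_exp_neg δ
  calc (1 - δ) ^ w ≤ Real.exp (-δ) ^ w := pow_le_pow_left₀ (by linarith) h w
    _ = Real.exp (-(δ * w)) := by rw [← Real.exp_nat_mul]; ring_nf

theorem natCast_pow_eq_exp {n : ℕ} (hn : 0 < n) (w : ℕ) :
    (n : ℝ) ^ w = Real.exp (w * Real.log n) := by
  rw [Real.exp_nat_mul, Real.exp_log (by exact_mod_cast hn)]

theorem tendsto_joined_bound {δ : ℝ} (hδ0 : 0 < δ) (hδ1 : δ ≤ 1) :
    Tendsto (fun n : ℕ => (n : ℝ) ^ (2 * slack δ n) * (1 - δ) ^ (slack δ n * slack δ n))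
      atTop (𝓝 0) := by
  refine squeeze_zero' (Eventually.of_forall fun n => ?_) ?_
    (tendsto_inv_atTop_zero.comp tendsto_natCast_atTop_atTop)
  · have : 0 ≤ 1 - δ := by linarith
    positivity
  · filter_upwards [eventually_gt_atTop 0] with n hn
    have h1 := one_sub_pow_le_exp hδ1 (slack δ n * slack δ n)
    have hl := Real.log_natCast_nonneg n
    have hs := le_slack hδ0 n
    have hs1 : (1 : ℝ) ≤ slack δ n := by
      unfold slack
      push_cast
      linarith [Nat.cast_nonneg (α := ℝ) ⌈3 / δ * Real.log n⌉₊]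
    calc _ ≤ Real.exp ((2 * slack δ n : ℕ) * Real.log n)
          * Real.exp (-(δ * (slack δ n * slack δ n : ℕ))) := by
          rw [← natCast_pow_eq_exp hn]
          gcongr
      _ ≤ Real.exp (-Real.log n) := by
          rw [← Real.exp_add, Real.exp_le_exp]
          push_cast
          -- Since `δ * slack ≥ 3 * log n`, the exponent is at most `-slack * log n`, and `slack ≥
          -- 1`.
          nlinarith
      _ = (n : ℝ)⁻¹ := by rw [Real.exp_neg, Real.exp_log (by exact_mod_cast hn)]

theorem tendsto_degree_bound {δ : ℝ} (hδ0 : 0 < δ) (hδ1 : δ ≤ 1) :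
    Tendsto (fun n : ℕ => (n : ℝ) ^ (3 * slack δ n + 1) * (1 - δ) ^ (n - 1 - 3 * slack δ n))
      atTop (𝓝 0) := by
  have hlim : Tendsto (fun n : ℕ => Real.exp (-(δ / 2 * n))) atTop (𝓝 0) :=
    Real.tendsto_exp_neg_atTop_nhds_zero.comp
      (tendsto_natCast_atTop_atTop.const_mul_atTop (half_pos hδ0))
  refine squeeze_zero' (Eventually.of_forall fun n => ?_) ?_ hlim
  · have : 0 ≤ 1 - δ := by linarith
    positivity
  -- The power of `n` and the loss `δ * (1 + 3 * slack)` in the exponent each cost at most `4 *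
  -- slack * log n`; together they must stay below `δ / 2 * n`.
  · have hη : 0 < δ / 16 := by positivity
    filter_upwards [eventually_gt_atTop 0, eventually_slack_mul_log_le hδ0 hη,
      tendsto_log_natCast_atTop.eventually_ge_atTop 1] with n hn hk hl
    have h1 := one_sub_pow_le_exp hδ1 (n - 1 - 3 * slack δ n)
    have hs1 : (1 : ℝ) ≤ slack δ n := by
      unfold slack
      push_cast
      linarith [Nat.cast_nonneg (α := ℝ) ⌈3 / δ * Real.log n⌉₊]
    have hsub : (n : ℝ) - 1 - 3 * slack δ n ≤ (n - 1 - 3 * slack δ n : ℕ) := by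
      have : n ≤ (n - 1 - 3 * slack δ n) + 1 + 3 * slack δ n := by omega
      have : (n : ℝ) ≤ (n - 1 - 3 * slack δ n : ℕ) + 1 + 3 * slack δ n := by exact_mod_cast this
      linarith
    calc _ ≤ Real.exp ((3 * slack δ n + 1 : ℕ) * Real.log n)
          * Real.exp (-(δ * (n - 1 - 3 * slack δ n : ℕ))) := by
          rw [← natCast_pow_eq_exp hn]
          gcongr
      _ ≤ Real.exp (-(δ / 2 * n)) := by
          rw [← Real.exp_add, Real.exp_le_exp]
          push_cast
          have a1 := mul_le_mul_of_nonneg_left hsub hδ0.le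
          have a2 : Real.log n ≤ slack δ n * Real.log n :=
            le_mul_of_one_le_left (by linarith) hs1
          have a3 : (slack δ n : ℝ) ≤ slack δ n * Real.log n :=
            le_mul_of_one_le_right (by linarith) hl
          have a4 : δ * (1 + 3 * slack δ n) ≤ 4 * (slack δ n * Real.log n) := by
            nlinarith
          nlinarith

theorem tendsto_pending_bound {δ : ℝ} (hδ0 : 0 < δ) {b : ℕ → ℕ} (hb : ∀ n, (b n : ℝ) ≤ n) :
    Tendsto (fun n : ℕ => 3 * (slack δ n : ℝ) *
      (3 * (((b n : ℝ) + 1) / (δ * (n.choose 2 : ℕ))))) atTop (𝓝 0) := by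
  rw [Metric.tendsto_atTop']
  intro c hc
  -- The estimates below multiply this by `3 * 3 * 2 * 4 / δ = 72 / δ`, which leaves `c / 2`.
  have hη : 0 < c * δ / 144 := by positivity
  have hev := (eventually_slack_le hδ0 hη).and (eventually_ge_atTop 2)
  obtain ⟨M, hM⟩ := eventually_atTop.1 hev
  refine ⟨M, fun n hn => ?_⟩
  obtain ⟨hs, h2⟩ := hM n hn.le
  have h2' : (2 : ℝ) ≤ n := by exact_mod_cast h2
  rw [Real.dist_eq, sub_zero, abs_of_nonneg (by positivity), Nat.cast_choose_two]
  have hb' : (b n : ℝ) + 1 ≤ 2 * n := by linarith [hb n]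
  have hch : (n : ℝ) * n / 4 ≤ (n : ℝ) * (n - 1) / 2 := by nlinarith
  generalize (n : ℝ) * (n - 1) / 2 = z at hch ⊢
  have hz : 0 ≤ z := le_trans (by positivity) hch
  calc 3 * (slack δ n : ℝ) * (3 * (((b n : ℝ) + 1) / (δ * z)))
      ≤ 3 * (c * δ / 144 * n) * (3 * ((2 * n) / (δ * ((n : ℝ) * n / 4)))) := by
        gcongr
    _ = c / 2 := by
        field_simp
        ring
    _ < c := by linarith

theorem tendsto_prob_edgeLevel_ne_zero {ε : ℝ} (hε0 : 0 < ε) (hε1 : ε < 1) {b : ℕ → ℕ}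
    (hb : ∀ n, (b n : ℝ) ≤ (1 - ε) * n) :
    Tendsto (fun n : ℕ => (play (b n) (planStrategy (b n) (edgeLevel n))).toOuterMeasure
        {γ | edgeLevel n (makerAfter (b n) (n / 2 + 1 + 2 * slack (ε / 2) n) γ) ≠ 0})
      atTop (𝓝 0) := by
  have hδ0 : 0 < ε / 2 := half_pos hε0
  have hδ1 : ε / 2 < 1 := by linarith
  have hb' : ∀ n, (b n : ℝ) ≤ n := fun n => (hb n).trans (by
    have : (0 : ℝ) ≤ n := Nat.cast_nonneg n
    nlinarith)
  have hlim := ((tendsto_joined_bound hδ0 hδ1.le).add (tendsto_degree_bound hδ0 hδ1.le)).add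
    (tendsto_pending_bound hδ0 hb')
  rw [add_zero, add_zero] at hlim
  have hlim' := ENNReal.tendsto_ofReal hlim
  rw [ENNReal.ofReal_zero] at hlim'
  refine tendsto_of_tendsto_of_tendsto_of_le_of_le' tendsto_const_nhds hlim'
    (Eventually.of_forall fun _ => zero_le) ?_
  filter_upwards [eventually_moves_le hε0 hε1,
    eventually_slack_le hδ0 (by norm_num : (0 : ℝ) < 1 / 4), eventually_gt_atTop 0]
    with n hm hs hn
  have hsn : 3 * slack (ε / 2) n < n := by
    have hn' : (0 : ℝ) < n := by exact_mod_cast hn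
    have : (3 * slack (ε / 2) n : ℝ) < n := by linarith
    exact_mod_cast this
  exact prob_edgeLevel_ne_zero_le hδ0 hδ1 (Nat.succ_pos _) hsn (hm (b n) (hb n))

theorem tendsto_prob_one_of_compl {l : Filter ℕ} {α : ℕ → Type} {p : ∀ n, PMF (α n)}
    {s t : ∀ n, Set (α n)}
    (ht : Tendsto (fun n => (p n).toOuterMeasure (t n)) l (𝓝 0))
    (hst : ∀ᶠ n in l, (t n)ᶜ ⊆ s n) :
    Tendsto (fun n => (p n).toOuterMeasure (s n)) l (𝓝 1) := by
  have h1 : Tendsto (fun n => 1 - (p n).toOuterMeasure (t n)) l (𝓝 1) := by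
    have := ENNReal.Tendsto.sub (tendsto_const_nhds (x := (1 : ℝ≥0∞)) (f := l)) ht
      (Or.inl ENNReal.one_ne_top)
    rwa [tsub_zero] at this
  refine tendsto_of_tendsto_of_tendsto_of_le_of_le' h1 tendsto_const_nhds ?_
    (Eventually.of_forall fun n => toOuterMeasure_le_one _ _)
  filter_upwards [hst] with n hn
  rw [tsub_le_iff_right]
  refine (one_le_toOuterMeasure_add_compl (p n) (t n)).trans ?_
  rw [add_comm]
  exact add_le_add (MeasureTheory.measure_mono hn) le_rfl

/-- For every margin there is a smaller margin below one that the rounded bias respects as well. -/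
theorem exists_margin {ε : ℝ} (hε : 0 < ε) :
    ∃ ε', 0 < ε' ∧ ε' < 1 ∧ ∀ n : ℕ, ((⌊(1 - ε) * (n : ℝ)⌋₊ : ℕ) : ℝ) ≤ (1 - ε') * n := by
  -- For `ε ≥ 1` the natural floor makes the bias zero, so the margin can be capped below one.
  refine ⟨min ε (1 / 2), by positivity, (min_le_right _ _).trans_lt (by norm_num), fun n => ?_⟩
  have hn : (0 : ℝ) ≤ n := Nat.cast_nonneg n
  have h1 : (1 - ε) * (n : ℝ) ≤ (1 - min ε (1 / 2)) * n :=
    mul_le_mul_of_nonneg_right (by linarith [min_le_left ε (1 / 2)]) hn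
  have h2 : 0 ≤ (1 - min ε (1 / 2)) * (n : ℝ) :=
    mul_nonneg (by linarith [min_le_right ε (1 / 2)]) hn
  calc ((⌊(1 - ε) * (n : ℝ)⌋₊ : ℕ) : ℝ) ≤ (⌊(1 - min ε (1 / 2)) * (n : ℝ)⌋₊ : ℕ) := by
        exact_mod_cast Nat.floor_mono h1
    _ ≤ _ := Nat.floor_le h2

/-! ### Breaker wins against too few moves -/

theorem le_two_mul_ncard_of_mem_minDegreeOneGame {n : ℕ} {A B : Set (KEdge n)}
    (hA : A ∈ minDegreeOneGame n) (hAB : A ⊆ B) : n ≤ 2 * B.ncard := by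
  classical
  rw [mem_minDegreeOneGame_iff] at hA
  have hB : ∀ v, ∃ e ∈ B.toFinset, v ∈ (e : Sym2 (Fin n)) := by
    intro v
    obtain ⟨w, hw⟩ := hA v
    obtain ⟨hne, he⟩ := graphOf_adj.1 hw
    exact ⟨kEdge hne, Set.mem_toFinset.2 (hAB he), Sym2.mem_mk_left v w⟩
  have hcov : (Finset.univ : Finset (Fin n))
      ⊆ B.toFinset.biUnion (fun e => (e : Sym2 (Fin n)).toFinset) := by
    intro v _
    obtain ⟨e, he, hv⟩ := hB v
    exact Finset.mem_biUnion.2 ⟨e, he, Sym2.mem_toFinset.2 hv⟩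
  have h1 := Finset.card_le_card hcov
  rw [Finset.card_univ, Fintype.card_fin] at h1
  refine h1.trans ?_
  rw [Set.ncard_eq_toFinset_card', mul_comm]
  refine Finset.card_biUnion_le_card_mul _ _ _ fun e _ => ?_
  obtain ⟨e, he⟩ := e
  induction e using Sym2.ind with
  | _ u v =>
    have : (s(u, v) : Sym2 (Fin n)).toFinset ⊆ {u, v} := by
      intro x hx
      simpa [Sym2.mem_iff] using Sym2.mem_toFinset.1 hx
    exact (Finset.card_le_card this).trans Finset.card_le_two

theorem ncard_makerSet_le {E : Type} [Finite E] (b : ℕ) (γ : List E) :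
    (makerSet b γ).ncard ≤ γ.length / (b + 1) + 1 := by
  classical
  have hsub : makerSet b γ ⊆ ((Finset.range (γ.length / (b + 1) + 1)).biUnion
      (fun i => (γ[i * (b + 1)]?).toFinset) : Finset E) := by
    rintro e ⟨i, hi⟩
    rw [Finset.mem_coe, Finset.mem_biUnion]
    refine ⟨i, ?_, by simp [hi]⟩
    have hlt := (List.getElem?_eq_some_iff.1 hi).1
    rw [Finset.mem_range, Nat.lt_succ_iff, Nat.le_div_iff_mul_le (Nat.succ_pos b)]
    exact hlt.le
  refine (Set.ncard_le_ncard hsub (Finset.finite_toSet _)).trans ?_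
  rw [Set.ncard_coe_finset]
  refine (Finset.card_biUnion_le_card_mul _ _ 1 fun i _ => ?_).trans (by simp)
  cases γ[i * (b + 1)]? <;> simp

/-- Counting alone decides: an edge covers two vertices, and Maker has too few edges in every
possible play. -/
theorem probBreakerWins_eq_one {n b : ℕ} {F : Set (Set (KEdge n))} (hF : F ⊆ minDegreeOneGame n)
    (S : Strategy (KEdge n)) (hb : 2 * (n.choose 2 / (b + 1) + 1) < n) :
    probBreakerWins F b S = 1 := by
  unfold probBreakerWins
  rw [PMF.toOuterMeasure_apply_eq_one_iff]
  rintro γ hγ ⟨A, hA, hAm⟩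
  have h1 := le_two_mul_ncard_of_mem_minDegreeOneGame (hF hA) hAm
  have h2 := ncard_makerSet_le b γ
  rw [(legal_of_mem_support hγ).2, min_self, card_kEdge] at h2
  omega

theorem eventually_few_moves {ε : ℝ} (hε : 0 < ε) :
    ∀ᶠ n : ℕ in atTop, 2 * (n.choose 2 / (⌊(1 + ε) * (n : ℝ)⌋₊ + 1) + 1) < n := by
  have hlim : Tendsto (fun n : ℕ => (1 - 1 / (1 + ε)) * (n : ℝ)) atTop atTop := by
    refine tendsto_natCast_atTop_atTop.const_mul_atTop ?_
    rw [sub_pos, div_lt_one (by linarith)]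
    linarith
  filter_upwards [hlim.eventually_gt_atTop 2, eventually_gt_atTop 0] with n h2 hn
  have hn' : (0 : ℝ) < n := by exact_mod_cast hn
  have hb : (1 + ε) * (n : ℝ) < (⌊(1 + ε) * (n : ℝ)⌋₊ + 1 : ℕ) := by
    push_cast
    exact Nat.lt_floor_add_one _
  have h1 : ((n.choose 2 / (⌊(1 + ε) * (n : ℝ)⌋₊ + 1) : ℕ) : ℝ) ≤ n / 2 * (1 / (1 + ε)) := by
    calc ((n.choose 2 / (⌊(1 + ε) * (n : ℝ)⌋₊ + 1) : ℕ) : ℝ)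
        ≤ (n.choose 2 : ℕ) / (⌊(1 + ε) * (n : ℝ)⌋₊ + 1 : ℕ) := Nat.cast_div_le
      _ ≤ (n * n / 2) / ((1 + ε) * n) := by
          rw [Nat.cast_choose_two]
          gcongr
          linarith
      _ = n / 2 * (1 / (1 + ε)) := by field_simp
  have : (2 * (((n.choose 2 / (⌊(1 + ε) * (n : ℝ)⌋₊ + 1) : ℕ) : ℝ) + 1)) < n := by
    linarith
  exact_mod_cast this

/-! ### The two sides of the threshold and the fast win -/

theorem tendsto_probBreakerWins {ε : ℝ} (hε : 0 < ε) {F : (n : ℕ) → Set (Set (KEdge n))}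
    (hF : ∀ n, F n ⊆ minDegreeOneGame n) {l : Filter ℕ} (hl : l ≤ atTop)
    (S : (n : ℕ) → Strategy (KEdge n)) :
    Tendsto (fun n => probBreakerWins (F n) ⌊(1 + ε) * (n : ℝ)⌋₊ (S n)) l (𝓝 1) := by
  refine tendsto_const_nhds.congr' ?_
  filter_upwards [hl (eventually_few_moves hε)] with n hn
  exact (probBreakerWins_eq_one (hF n) (S n) hn).symm

theorem exists_tendsto_probMakerWins {ε : ℝ} (hε : 0 < ε) {F : (n : ℕ) → Set (Set (KEdge n))}
    {l : Filter ℕ} (hl : l ≤ atTop)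
    (hF : ∀ᶠ n in l, ∀ A, edgeLevel n A = 0 → A ∈ F n) :
    ∃ S : (n : ℕ) → Strategy (KEdge n),
      Tendsto (fun n => probMakerWins (F n) ⌊(1 - ε) * (n : ℝ)⌋₊ (S n)) l (𝓝 1) := by
  obtain ⟨ε', h0, h1, hb⟩ := exists_margin hε
  refine ⟨fun n => planStrategy ⌊(1 - ε) * (n : ℝ)⌋₊ (edgeLevel n),
    tendsto_prob_one_of_compl ((tendsto_prob_edgeLevel_ne_zero h0 h1 hb).mono_left hl) ?_⟩
  filter_upwards [hF] with n hn γ hγ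
  rw [Set.mem_compl_iff, Set.mem_ofPred_eq, not_not] at hγ
  exact ⟨_, hn _ hγ, makerAfter_subset_makerSet _ _ _⟩

end Asymptotics

theorem exists_tendsto_probMakerWinsWithin {ε : ℝ} (hε : 0 < ε)
    {F : (n : ℕ) → Set (Set (KEdge n))} {l : Filter ℕ} (hl : l ≤ atTop)
    (hF : ∀ᶠ n in l, ∀ A, edgeLevel n A = 0 → A ∈ F n) :
    ∃ C : ℝ, ∃ S : (n : ℕ) → Strategy (KEdge n),
      Tendsto (fun n : ℕ => probMakerWinsWithin (F n) ⌊(1 - ε) * (n : ℝ)⌋₊ (S n)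
        ⌊(n : ℝ) / 2 + C * Real.log (n : ℝ)⌋₊) l (𝓝 1) := by
  obtain ⟨ε', h0, h1, hb⟩ := exists_margin hε
  -- `1 + 2 * slack` is at most `2 * (3 / (ε' / 2)) * log n + 5`, and the `5` is absorbed once `log
  -- n ≥ 1`.
  refine ⟨2 * (3 / (ε' / 2)) + 5, fun n => planStrategy ⌊(1 - ε) * (n : ℝ)⌋₊ (edgeLevel n),
    tendsto_prob_one_of_compl ((tendsto_prob_edgeLevel_ne_zero h0 h1 hb).mono_left hl) ?_⟩
  filter_upwards [hF, hl (tendsto_log_natCast_atTop.eventually_ge_atTop 1)] with n hn hlog γ hγ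
  rw [Set.mem_compl_iff, Set.mem_ofPred_eq, not_not] at hγ
  refine ⟨_, hn _ hγ, makerAfter_mono _ _ (Nat.le_floor ?_)⟩
  have hs := slack_le (half_pos h0) n
  have hdiv : ((n / 2 : ℕ) : ℝ) ≤ (n : ℝ) / 2 := Nat.cast_div_le
  push_cast at hdiv ⊢
  nlinarith

theorem evenAtTop_le : evenAtTop ≤ atTop := inf_le_left

theorem eventually_evenAtTop : ∀ᶠ n in evenAtTop, Even n :=
  mem_inf_of_right (mem_principal_self _)

end HalfRandom

end

theorem theorem1 :
    (∀ ε : ℝ, 0 < ε → ∃ C : ℝ, ∃ S : (n : ℕ) → HalfRandom.Strategy (HalfRandom.KEdge n),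
      Tendsto (fun n : ℕ =>
          HalfRandom.probMakerWinsWithin (HalfRandom.perfectMatchingGame n)
            ⌊(1 - ε) * (n : ℝ)⌋₊ (S n) ⌊(n : ℝ) / 2 + C * Real.log (n : ℝ)⌋₊)
        HalfRandom.evenAtTop (𝓝 1)) ∧
    HalfRandom.IsSharpThresholdBias HalfRandom.evenAtTop HalfRandom.perfectMatchingGame
      (fun n => n) ∧
    HalfRandom.IsSharpThresholdBias atTop HalfRandom.minDegreeOneGame (fun n => n) := by
  have hPM : ∀ᶠ n in HalfRandom.evenAtTop, ∀ A, HalfRandom.edgeLevel n A = 0 →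
      A ∈ HalfRandom.perfectMatchingGame n := by
    filter_upwards [HalfRandom.eventually_evenAtTop] with n hn A hA
    exact HalfRandom.mem_perfectMatchingGame_of_edgeLevel hA hn
  refine ⟨fun ε hε =>
    HalfRandom.exists_tendsto_probMakerWinsWithin hε HalfRandom.evenAtTop_le hPM,
    fun ε hε => ⟨fun S => ?_, ?_⟩, fun ε hε => ⟨fun S => ?_, ?_⟩⟩
  · exact HalfRandom.tendsto_probBreakerWins hε
      (fun n => HalfRandom.perfectMatchingGame_subset) HalfRandom.evenAtTop_le S
  · exact HalfRandom.exists_tendsto_probMakerWins hε HalfRandom.evenAtTop_le hPM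
  · exact HalfRandom.tendsto_probBreakerWins hε (fun n => subset_rfl) le_rfl S
  · exact HalfRandom.exists_tendsto_probMakerWins hε le_rfl
      (Eventually.of_forall fun n A hA => HalfRandom.mem_minDegreeOneGame_of_edgeLevel hA)
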